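/- For $a=(D,F)\in\mathbb{R}^2$ let $X_a$ be the Loud system $\dot u=-v+uv$, $\dot v=u+Du^2+Fv^2$. For a vector field with a center at the origin, let its period annulus $\mathscr P$ be the largest connected punctured neighbourhood of the origin that is covered by periodic orbits, and let the outer boundary of $\mathscr P$ be its boundary in the Poincaré disc (the closed disc obtained from $\mathbb{R}^2$ by adding a circle at infinity), with the center removed. A periodic orbit $\gamma\subset\mathscr P$ is critical if the derivative of the period function (the function assigning to each periodic orbit its minimal period) vanishes at $\gamma$ when the periodic orbits near $\gamma$ are parametrized by a transverse section. Theorem. Every parameter $a_0=(D,1)$ with $D\in(-1,0)\setminus\{-\frac12\}$ is a local regular value of the period function of the center at the origin at the outer boundary of the period annulus, that is, no critical periods bifurcate from the outer boundary at $a_0$: there are a neighbourhood $U$ of $a_0$ in $\mathbb{R}^2$ and a subset $V$ of the Poincaré disc such that for every $a=(D',F')\in U$ the origin is a center of $X_a$, $V$ is a neighbourhood of the outer boundary of its period annulus, and no periodic orbit of $X_a$ in the period annulus that is contained in $V$ is critical. -/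

import Mathlib

open Set Filter Topology

namespace PlanarCenter

/-- A solution of the autonomous system `x' = X x`, defined for all times. -/
def IsSolution (X : ℝ × ℝ → ℝ × ℝ) (γ : ℝ → ℝ × ℝ) : Prop :=
  ∀ t : ℝ, HasDerivAt γ (X (γ t)) t

/-- `T` is a (positive, not necessarily minimal) period of the solution starting at `q`. -/
def IsPeriod (X : ℝ × ℝ → ℝ × ℝ) (q : ℝ × ℝ) (T : ℝ) : Prop :=
  0 < T ∧ ∃ γ : ℝ → ℝ × ℝ, IsSolution X γ ∧ γ 0 = q ∧ Function.Periodic γ T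

/-- The points that lie on a periodic orbit which is not a singular point. -/
def periodicPoints (X : ℝ × ℝ → ℝ × ℝ) : Set (ℝ × ℝ) :=
  {q | X q ≠ 0 ∧ ∃ T : ℝ, IsPeriod X q T}

/-- The orbit through `q` (used for points `q` on periodic orbits). -/
def orbit (X : ℝ × ℝ → ℝ × ℝ) (q : ℝ × ℝ) : Set (ℝ × ℝ) :=
  {r | ∃ γ : ℝ → ℝ × ℝ, IsSolution X γ ∧ γ 0 = q ∧ ∃ t : ℝ, γ t = r}

/-- The minimal period of the periodic orbit through `q`. As a function of `q` this is the period
function, seen as a function on the plane that is constant along each periodic orbit. -/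
noncomputable def period (X : ℝ × ℝ → ℝ × ℝ) (q : ℝ × ℝ) : ℝ :=
  sInf {T | IsPeriod X q T}

/-- `p` is a center: a singular point with a punctured neighbourhood covered by periodic orbits. -/
def IsCenter (X : ℝ × ℝ → ℝ × ℝ) (p : ℝ × ℝ) : Prop :=
  X p = 0 ∧ ∀ᶠ q in 𝓝[≠] p, q ∈ periodicPoints X

/-- The period annulus of the center `p`: the largest connected punctured neighbourhood of `p`
that is entirely covered by periodic orbits. -/
def periodAnnulus (X : ℝ × ℝ → ℝ × ℝ) (p : ℝ × ℝ) : Set (ℝ × ℝ) :=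
  {q | q ≠ p ∧ ∃ N : Set (ℝ × ℝ),
    IsOpen N ∧ IsConnected N ∧ p ∈ N ∧ q ∈ N ∧ N \ {p} ⊆ periodicPoints X}

/-- The embedding of the plane in the Poincaré disc `{x² + y² ≤ 1}`, whose boundary circle
is the line at infinity (one point for each direction). -/
noncomputable def toDisc (q : ℝ × ℝ) : ℝ × ℝ :=
  (q.1 / √(1 + q.1 ^ 2 + q.2 ^ 2), q.2 / √(1 + q.1 ^ 2 + q.2 ^ 2))

/-- The outer boundary of the period annulus: its boundary in the Poincaré disc, without the
center (the inner boundary). As the image of the plane is the open disc, the frontier in `ℝ²` is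
also the frontier relative to the closed disc. -/
noncomputable def outerBoundary (X : ℝ × ℝ → ℝ × ℝ) (p : ℝ × ℝ) : Set (ℝ × ℝ) :=
  frontier (toDisc '' periodAnnulus X p) \ {toDisc p}

/-- The periodic orbit through `q` is a critical periodic orbit (its period is a critical period):
for a transverse section `σ` with `σ 0 = q`, the period of the orbit through `σ s`, as
a function of `s`, has zero derivative at `s = 0`. For a smooth `X` this does not depend on the
section; quantified existentially, its negation says that along every section the derivative
exists and is different from zero. -/
def IsCritical (X : ℝ × ℝ → ℝ × ℝ) (q : ℝ × ℝ) : Prop :=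
  ∃ σ : ℝ → ℝ × ℝ, ContDiffAt ℝ 1 σ 0 ∧ σ 0 = q ∧
    LinearIndependent ℝ ![X q, deriv σ 0] ∧ deriv (fun s => period X (σ s)) 0 = 0

/-- `a₀` is a local regular value of the period function of the center `p` at the outer boundary
of the period annulus: for all parameters `a` in a neighbourhood `U` of `a₀`, the point `p` is
a center of `X a`, and no periodic orbit in its period annulus that lies in `V` is critical, where
`V` does not depend on `a` and is a neighbourhood, in the Poincaré disc, of the outer boundary
of the period annulus for `a₀` and for all `a ∈ U`. -/
def IsLocalRegularValueAtOuterBoundary {Λ : Type*} [TopologicalSpace Λ]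
    (X : Λ → ℝ × ℝ → ℝ × ℝ) (p : ℝ × ℝ) (a₀ : Λ) : Prop :=
  ∃ U ∈ 𝓝 a₀, ∃ V : Set (ℝ × ℝ), ∀ a ∈ U,
    IsCenter (X a) p ∧
    V ∈ 𝓝ˢ (outerBoundary (X a) p) ∧
    ∀ q ∈ periodAnnulus (X a) p, toDisc '' orbit (X a) q ⊆ V → ¬ IsCritical (X a) q

/-- The Loud family `u' = -v + u v`, `v' = u + D u² + F v²`, with parameter `a = (D, F)`. -/
def loud (a : ℝ × ℝ) (x : ℝ × ℝ) : ℝ × ℝ :=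
  (-x.2 + x.1 * x.2, x.1 + a.1 * x.1 ^ 2 + a.2 * x.2 ^ 2)

end PlanarCenter

/-!
In the coordinates `s = (1 - u) ^ (-F)` and `p = -F s v` a Loud system with `F > 0` is, in the half
plane `u < 1`, the Newton equation `s'' = -f s` of a potential well on the half line `s > 0`, with
`f s = (s - s ^ η) (a + c s ^ (η - 1))`, `a = F (1 + D)`, `c = -F D`, `η = 1 - 1 / F`. The invariant
line `u = 1` corresponds to `s = ∞`. For `F = 1` this is a harmonic oscillator, centred at
`(a - c) / (2 a)`, with a logarithmic wall at `s = 0`. Each period consists of about half a period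
of the oscillator; the offset of its centre from the wall makes the period depend on the amplitude
`ρ`, and as `ρ` tends to infinity the derivative of the period is of order `(a - c) ρ ^ (-2)`, where
`a - c = 1 + 2 D ≠ 0`. The theorem says that this persists for `F` near `1`, uniformly up to the
outer boundary.

Let `W` be the potential, `r = ± √(2 W)` the amplitude coordinate and `S` its inverse. The orbits
are circles in the plane of `r` and `p`, and the period is `T ρ = 2 ∫ S' (ρ sin θ) dθ` over
`[-π / 2, π / 2]`. Hence
`ρ ^ 2 T' / 2 = ρ ∫ r S'' r cos θ dθ + ρ ∫ r S'' r (1 - cos θ) dθ` with `r = ρ sin θ`.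
The first integral is exact and equals the boundary terms `r S' r - S r` between `-ρ` and `ρ`
(`IsWell.integral_curvature_mul_cos`). At the outer turning point `M = S ρ` they equal
`(2 W - M f) / f`, which is of the exact order `(a - c) M ^ η` (`WallBounds.le_abs_virial`), and at
the inner one they are tiny. The second integral is small because `r S'' r` is bounded by a multiple
of `|η| r ^ (η - 1) + r ^ (-7 / 4)` (`WallBounds.exists_curvature_bound`): the numerator
`f ^ 2 - 2 W f'` of `S''` has the derivative `-2 W f''`, in which the leading part of `f` has
disappeared. All constants depend only on bounds for `a`, `c`, `a - c` and `η`, so that large orbits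
are not critical uniformly in the parameters
(`WallBounds.exists_forall_deriv_period_ne_zero`).

For the set `V` one takes the complement, in the Poincaré disc, of a segment `[0, u₁]` of the axis
`v = 0`. Each periodic orbit of the annulus meets this axis at its outer turning point, so orbits in
`V` are large. The segment lies in the period annulus, or is the center, for all nearby parameters:
for `F > 1` the wall has a finite height, but this height tends to infinity as `F` tends to `1`
(`WallBounds.pot_exp_ge`).
-/

open MeasureTheory

/-! ### Potential wells on the half line -/

/-- `f` is the force (with the sign changed) of a potential well on the half line `s > 0`, i.e. the
potential `∫₁ˢ f` of `s'' = -f s` has its only critical point, a nondegenerate minimum, at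
`s = 1`. The derivative `f'` of `f` is part of the data. -/
structure IsWell (f f' : ℝ → ℝ) : Prop where
  hasDerivAt : ∀ s, 0 < s → HasDerivAt f (f' s) s
  continuousOn_deriv : ContinuousOn f' (Ioi 0)
  pos : ∀ s, 1 < s → 0 < f s
  neg : ∀ s, 0 < s → s < 1 → f s < 0
  deriv_pos : 0 < f' 1

namespace IsWell

/-- The potential of the force, normalized to vanish at the minimum. -/
noncomputable def pot (f : ℝ → ℝ) (s : ℝ) : ℝ := ∫ t in (1 : ℝ)..s, f t

/-- The signed square root of twice the potential. In this coordinate the potential is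
`r ^ 2 / 2`, so that the level sets of the energy are circles. -/
noncomputable def amp (f : ℝ → ℝ) (s : ℝ) : ℝ :=
  if 1 ≤ s then √(2 * pot f s) else -√(2 * pot f s)

/-- The values of the coordinate `amp`: an open interval around `0`. -/
def ampRange (f : ℝ → ℝ) : Set ℝ := amp f '' Ioi 0

/-- The inverse of the coordinate `amp`. Only its values on `ampRange f` are meaningful. -/
noncomputable def position (f : ℝ → ℝ) (r : ℝ) : ℝ := Function.invFunOn (amp f) (Ioi 0) r

/-- The derivative of `position`. The quotient is `0 / 0` at `r = 0`, where its limit is put. -/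
noncomputable def slope (f f' : ℝ → ℝ) (r : ℝ) : ℝ :=
  if r = 0 then (√(f' 1))⁻¹ else r / f (position f r)

/-- The second derivative of `position`, away from `0`. -/
noncomputable def curvature (f f' : ℝ → ℝ) (r : ℝ) : ℝ :=
  (f (position f r) ^ 2 - r ^ 2 * f' (position f r)) / f (position f r) ^ 3

variable {f f' : ℝ → ℝ} {r s t : ℝ}

theorem continuousOn (h : IsWell f f') : ContinuousOn f (Ioi 0) :=
  fun s hs => (h.hasDerivAt s hs).continuousAt.continuousWithinAt

theorem intervalIntegrable (h : IsWell f f') (hs : 0 < s) (ht : 0 < t) :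
    IntervalIntegrable f volume s t :=
  (h.continuousOn.mono (fun _ hx => lt_of_lt_of_le (lt_min hs ht) hx.1)).intervalIntegrable

theorem map_one (h : IsWell f f') : f 1 = 0 := by
  have hc : ContinuousAt f 1 := (h.hasDerivAt 1 one_pos).continuousAt
  apply le_antisymm
  · refine le_of_tendsto (hc.tendsto.mono_left (nhdsWithin_le_nhds (s := Iio 1))) ?_
    filter_upwards [Ioo_mem_nhdsLT (zero_lt_one (α := ℝ))] with s hs
    exact (h.neg s hs.1 hs.2).le
  · refine ge_of_tendsto (hc.tendsto.mono_left (nhdsWithin_le_nhds (s := Ioi 1))) ?_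
    filter_upwards [self_mem_nhdsWithin] with s hs
    exact (h.pos s hs).le

theorem force_ne_zero (h : IsWell f f') (hs : 0 < s) (hs1 : s ≠ 1) : f s ≠ 0 := by
  rcases lt_or_gt_of_ne hs1 with h1 | h1
  · exact (h.neg s hs h1).ne
  · exact (h.pos s h1).ne'

theorem hasDerivAt_pot (h : IsWell f f') (hs : 0 < s) : HasDerivAt (pot f) (f s) s := by
  refine intervalIntegral.integral_hasDerivAt_right (h.intervalIntegrable one_pos hs) ?_
    (h.hasDerivAt s hs).continuousAt
  exact h.continuousOn.stronglyMeasurableAtFilter isOpen_Ioi s hs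

theorem continuousOn_pot (h : IsWell f f') : ContinuousOn (pot f) (Ioi 0) :=
  fun _ hs => (h.hasDerivAt_pot hs).continuousAt.continuousWithinAt

@[simp] theorem pot_one : pot f 1 = 0 := by simp [pot]

theorem strictMonoOn_pot (h : IsWell f f') : StrictMonoOn (pot f) (Ici 1) := by
  refine strictMonoOn_of_deriv_pos (convex_Ici 1)
    (h.continuousOn_pot.mono fun x (hx : 1 ≤ x) => one_pos.trans_le hx) fun x hx => ?_
  rw [interior_Ici] at hx
  rw [(h.hasDerivAt_pot (one_pos.trans hx)).deriv]
  exact h.pos x hx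

theorem strictAntiOn_pot (h : IsWell f f') : StrictAntiOn (pot f) (Ioc 0 1) := by
  refine strictAntiOn_of_deriv_neg (convex_Ioc 0 1)
    (h.continuousOn_pot.mono fun x hx => hx.1) fun x hx => ?_
  rw [interior_Ioc] at hx
  rw [(h.hasDerivAt_pot hx.1).deriv]
  exact h.neg x hx.1 hx.2

theorem pot_pos (h : IsWell f f') (hs : 0 < s) (hs1 : s ≠ 1) : 0 < pot f s := by
  rcases lt_or_gt_of_ne hs1 with h1 | h1
  · simpa using h.strictAntiOn_pot ⟨hs, h1.le⟩ ⟨one_pos, le_rfl⟩ h1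
  · simpa using h.strictMonoOn_pot (mem_Ici.2 le_rfl) (mem_Ici.2 h1.le) h1

theorem pot_nonneg (h : IsWell f f') (hs : 0 < s) : 0 ≤ pot f s := by
  rcases eq_or_ne s 1 with rfl | h1
  · simp
  · exact (h.pot_pos hs h1).le

@[simp] theorem amp_one : amp f 1 = 0 := by simp [amp]

theorem amp_sq (h : IsWell f f') (hs : 0 < s) : amp f s ^ 2 = 2 * pot f s := by
  have := h.pot_nonneg hs
  unfold amp
  split_ifs
  · rw [Real.sq_sqrt (by positivity)]
  · rw [neg_sq, Real.sq_sqrt (by positivity)]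

theorem abs_amp : |amp f s| = √(2 * pot f s) := by
  unfold amp
  split_ifs <;> simp [abs_of_nonneg (Real.sqrt_nonneg _)]

theorem amp_pos (h : IsWell f f') (hs : 1 < s) : 0 < amp f s := by
  have := h.pot_pos (one_pos.trans hs) hs.ne'
  rw [amp, if_pos hs.le]
  positivity

theorem amp_neg (h : IsWell f f') (hs : 0 < s) (hs1 : s < 1) : amp f s < 0 := by
  have := h.pot_pos hs hs1.ne
  rw [amp, if_neg (not_le.2 hs1), neg_lt_zero]
  positivity

theorem strictMonoOn_amp (h : IsWell f f') : StrictMonoOn (amp f) (Ioi 0) := by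
  intro x hx y hy hxy
  rcases lt_or_ge x 1 with hx1 | hx1
  · rcases lt_or_ge y 1 with hy1 | hy1
    · rw [amp, amp, if_neg (not_le.2 hx1), if_neg (not_le.2 hy1), neg_lt_neg_iff]
      refine Real.sqrt_lt_sqrt (mul_nonneg two_pos.le (h.pot_nonneg hy)) ?_
      linarith [h.strictAntiOn_pot ⟨hx, hx1.le⟩ ⟨hy, hy1.le⟩ hxy]
    · refine (h.amp_neg hx hx1).trans_le ?_
      rw [amp, if_pos hy1]
      positivity
  · have hy1 : 1 ≤ y := hx1.trans hxy.le
    rw [amp, amp, if_pos hx1, if_pos hy1]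
    refine Real.sqrt_lt_sqrt (mul_nonneg two_pos.le (h.pot_nonneg hx)) ?_
    linarith [h.strictMonoOn_pot (mem_Ici.2 hx1) (mem_Ici.2 hy1) hxy]

theorem hasDerivAt_amp (h : IsWell f f') (hs : 0 < s) (hs1 : s ≠ 1) :
    HasDerivAt (amp f) (f s / amp f s) s := by
  have hp := h.pot_pos hs hs1
  have hd : HasDerivAt (fun x => √(2 * pot f x)) (2 * f s / (2 * √(2 * pot f s))) s :=
    ((h.hasDerivAt_pot hs).const_mul 2).sqrt (by positivity)
  rcases lt_or_gt_of_ne hs1 with h1 | h1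
  · have : amp f =ᶠ[𝓝 s] fun x => -√(2 * pot f x) := by
      filter_upwards [Iio_mem_nhds h1] with x hx
      rw [amp, if_neg (not_le.2 hx)]
    rw [this.hasDerivAt_iff, this.eq_of_nhds]
    refine hd.fun_neg.congr_deriv ?_
    rw [mul_div_mul_left _ _ two_ne_zero, div_neg]
  · have : amp f =ᶠ[𝓝 s] fun x => √(2 * pot f x) := by
      filter_upwards [Ioi_mem_nhds h1] with x hx
      rw [amp, if_pos (le_of_lt hx)]
    rw [this.hasDerivAt_iff, this.eq_of_nhds]
    exact hd.congr_deriv (mul_div_mul_left _ _ two_ne_zero)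

theorem continuousAt_amp (h : IsWell f f') (hs : 0 < s) : ContinuousAt (amp f) s := by
  rcases eq_or_ne s 1 with rfl | h1
  · rw [ContinuousAt, amp_one, tendsto_zero_iff_abs_tendsto_zero]
    have : Tendsto (fun x => √(2 * pot f x)) (𝓝 1) (𝓝 (√(2 * pot f 1))) :=
      ((h.hasDerivAt_pot one_pos).continuousAt.const_mul 2).sqrt
    simpa [Function.comp_def, abs_amp] using this
  · exact (h.hasDerivAt_amp hs h1).continuousAt

theorem position_amp (h : IsWell f f') (hs : 0 < s) : position f (amp f s) = s :=
  h.strictMonoOn_amp.injOn.leftInvOn_invFunOn hs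

theorem position_pos (hr : r ∈ ampRange f) : 0 < position f r :=
  Function.invFunOn_mem hr

theorem amp_position (hr : r ∈ ampRange f) : amp f (position f r) = r :=
  Function.invFunOn_eq hr

theorem ampRange_mem_nhds (h : IsWell f f') (hr : r ∈ ampRange f) : ampRange f ∈ 𝓝 r := by
  obtain ⟨s, hs, rfl⟩ := hr
  have hs : 0 < s := hs
  have hcont : ContinuousOn (amp f) (Icc (s / 2) (2 * s)) := fun x hx =>
    (h.continuousAt_amp (by linarith [hx.1] : (0 : ℝ) < x)).continuousWithinAt
  refine mem_of_superset (Icc_mem_nhds (h.strictMonoOn_amp (half_pos hs) hs (half_lt_self hs))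
    (h.strictMonoOn_amp hs (mul_pos two_pos hs) (by linarith : s < 2 * s))) ?_
  refine (intermediate_value_Icc (by linarith) hcont).trans (image_mono fun x hx => ?_)
  exact lt_of_lt_of_le (half_pos hs) hx.1

theorem isOpen_ampRange (h : IsWell f f') : IsOpen (ampRange f) :=
  isOpen_iff_mem_nhds.2 fun _ hr => h.ampRange_mem_nhds hr

theorem ordConnected_ampRange (h : IsWell f f') : (ampRange f).OrdConnected :=
  (isPreconnected_Ioi.image _ fun _ hs =>
    (h.continuousAt_amp hs).continuousWithinAt).ordConnected

theorem zero_mem_ampRange : (0 : ℝ) ∈ ampRange f := ⟨1, mem_Ioi.2 one_pos, amp_one⟩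

theorem strictMonoOn_position (h : IsWell f f') : StrictMonoOn (position f) (ampRange f) := by
  rintro _ ⟨x, hx, rfl⟩ _ ⟨y, hy, rfl⟩ hxy
  rw [h.position_amp hx, h.position_amp hy]
  exact (h.strictMonoOn_amp.lt_iff_lt hx hy).1 hxy

theorem image_position (h : IsWell f f') : position f '' ampRange f = Ioi 0 := by
  ext s
  constructor
  · rintro ⟨r, hr, rfl⟩
    exact position_pos hr
  · exact fun hs => ⟨amp f s, ⟨s, hs, rfl⟩, h.position_amp hs⟩

theorem continuousAt_position (h : IsWell f f') (hr : r ∈ ampRange f) :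
    ContinuousAt (position f) r := by
  refine h.strictMonoOn_position.continuousAt_of_image_mem_nhds (h.ampRange_mem_nhds hr) ?_
  rw [h.image_position]
  exact Ioi_mem_nhds (position_pos hr)

@[simp] theorem position_zero (h : IsWell f f') : position f 0 = 1 := by
  simpa using h.position_amp one_pos

theorem position_ne_one (hr : r ∈ ampRange f) (hr0 : r ≠ 0) : position f r ≠ 1 := by
  intro h1
  apply hr0
  rw [← amp_position hr, h1, amp_one]

theorem one_lt_position (h : IsWell f f') (hr : r ∈ ampRange f) (hr0 : 0 < r) :
    1 < position f r := by
  simpa [h.position_zero] using h.strictMonoOn_position zero_mem_ampRange hr hr0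

theorem position_lt_one (h : IsWell f f') (hr : r ∈ ampRange f) (hr0 : r < 0) :
    position f r < 1 := by
  simpa [h.position_zero] using h.strictMonoOn_position hr zero_mem_ampRange hr0

theorem two_mul_pot_position (h : IsWell f f') (hr : r ∈ ampRange f) :
    2 * pot f (position f r) = r ^ 2 := by
  rw [← h.amp_sq (position_pos hr), amp_position hr]

theorem force_position_ne_zero (h : IsWell f f') (hr : r ∈ ampRange f) (hr0 : r ≠ 0) :
    f (position f r) ≠ 0 :=
  h.force_ne_zero (position_pos hr) (position_ne_one hr hr0)

theorem slope_pos (h : IsWell f f') (hr : r ∈ ampRange f) : 0 < slope f f' r := by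
  unfold slope
  split_ifs with h0
  · have := h.deriv_pos
    positivity
  · rcases lt_or_gt_of_ne h0 with h1 | h1
    · exact div_pos_of_neg_of_neg h1 (h.neg _ (position_pos hr) (h.position_lt_one hr h1))
    · exact div_pos h1 (h.pos _ (h.one_lt_position hr h1))

theorem slope_of_ne (hr0 : r ≠ 0) : slope f f' r = r / f (position f r) := if_neg hr0

theorem hasDerivAt_position_of_ne (h : IsWell f f') (hr : r ∈ ampRange f) (hr0 : r ≠ 0) :
    HasDerivAt (position f) (slope f f' r) r := by
  have hf := h.force_position_ne_zero hr hr0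
  have hd := h.hasDerivAt_amp (position_pos hr) (position_ne_one hr hr0)
  rw [amp_position hr] at hd
  have := hd.of_local_left_inverse (h.continuousAt_position hr) (div_ne_zero hf hr0)
    (by filter_upwards [h.ampRange_mem_nhds hr] with y hy using amp_position hy)
  rwa [inv_div, ← slope_of_ne (f' := f') hr0] at this

theorem tendsto_pot_div_sq (h : IsWell f f') :
    Tendsto (fun s => 2 * pot f s / f s ^ 2) (𝓝[≠] 1) (𝓝 (f' 1)⁻¹) := by
  have hpos : ∀ᶠ s in 𝓝[≠] (1 : ℝ), 0 < s ∧ s ≠ 1 := by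
    filter_upwards [nhdsWithin_le_nhds (Ioi_mem_nhds (zero_lt_one (α := ℝ))),
      self_mem_nhdsWithin] with s h1 h2 using ⟨h1, h2⟩
  have hc' : ContinuousAt f' 1 := h.continuousOn_deriv.continuousAt (Ioi_mem_nhds one_pos)
  have hf'pos : ∀ᶠ s in 𝓝[≠] (1 : ℝ), 0 < f' s :=
    nhdsWithin_le_nhds (hc'.eventually_const_lt h.deriv_pos)
  have hc : ContinuousAt f 1 := (h.hasDerivAt 1 one_pos).continuousAt
  refine HasDerivAt.lhopital_zero_nhdsNE (f' := fun s => 2 * f s)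
    (g' := fun s => 2 * f s * f' s) ?_ ?_ ?_ ?_ ?_ ?_
  · filter_upwards [hpos] with s hs using (h.hasDerivAt_pot hs.1).const_mul 2
  · filter_upwards [hpos] with s hs
    simpa using (h.hasDerivAt s hs.1).fun_pow 2
  · filter_upwards [hpos, hf'pos] with s hs hs'
    exact mul_ne_zero (mul_ne_zero two_ne_zero (h.force_ne_zero hs.1 hs.2)) hs'.ne'
  · have : Tendsto (fun x => 2 * pot f x) (𝓝 1) (𝓝 (2 * pot f 1)) :=
      (h.hasDerivAt_pot one_pos).continuousAt.const_mul 2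
    simpa using this.mono_left nhdsWithin_le_nhds
  · have : Tendsto (fun x => f x ^ 2) (𝓝 1) (𝓝 (f 1 ^ 2)) := hc.pow 2
    simpa [h.map_one] using this.mono_left nhdsWithin_le_nhds
  · have : Tendsto (fun s => (f' s)⁻¹) (𝓝[≠] 1) (𝓝 (f' 1)⁻¹) :=
      (hc'.inv₀ h.deriv_pos.ne').tendsto.mono_left nhdsWithin_le_nhds
    refine this.congr' ?_
    filter_upwards [hpos, hf'pos] with s hs hs'
    have := h.force_ne_zero hs.1 hs.2
    field_simp

theorem continuousAt_slope_zero (h : IsWell f f') : ContinuousAt (slope f f') 0 := by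
  rw [continuousAt_iff_punctured_nhds]
  have h0 : slope f f' 0 = √((f' 1)⁻¹) := by simp [slope]
  rw [h0]
  have hp : Tendsto (position f) (𝓝[≠] 0) (𝓝[≠] 1) := by
    refine tendsto_nhdsWithin_iff.2 ⟨?_, ?_⟩
    · have := (h.continuousAt_position zero_mem_ampRange).tendsto
      rw [h.position_zero] at this
      exact this.mono_left nhdsWithin_le_nhds
    · filter_upwards [nhdsWithin_le_nhds (h.ampRange_mem_nhds zero_mem_ampRange),
        self_mem_nhdsWithin] with r hr hr0 using position_ne_one hr hr0
  refine ((h.tendsto_pot_div_sq.comp hp).sqrt).congr' ?_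
  filter_upwards [nhdsWithin_le_nhds (h.ampRange_mem_nhds zero_mem_ampRange),
        self_mem_nhdsWithin] with r hr hr0
  rw [Function.comp, h.two_mul_pot_position hr, ← div_pow, ← slope_of_ne (f' := f') hr0,
    Real.sqrt_sq (h.slope_pos hr).le]

theorem hasDerivAt_slope (h : IsWell f f') (hr : r ∈ ampRange f) (hr0 : r ≠ 0) :
    HasDerivAt (slope f f') (curvature f f' r) r := by
  have hf := h.force_position_ne_zero hr hr0
  have h1 : HasDerivAt (fun x => f (position f x)) (f' (position f r) * slope f f' r) r :=
    (h.hasDerivAt _ (position_pos hr)).comp r (h.hasDerivAt_position_of_ne hr hr0)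
  have h2 := (hasDerivAt_id r).div h1 hf
  have h3 : slope f f' =ᶠ[𝓝 r] (id / fun x => f (position f x)) := by
    filter_upwards [isOpen_ne.mem_nhds hr0] with x hx
    rw [slope_of_ne hx]
    rfl
  rw [h3.hasDerivAt_iff]
  refine h2.congr_deriv ?_
  rw [slope_of_ne hr0, curvature]
  simp only [id]
  field_simp

theorem continuousAt_slope (h : IsWell f f') (hr : r ∈ ampRange f) :
    ContinuousAt (slope f f') r := by
  rcases eq_or_ne r 0 with rfl | hr0
  · exact h.continuousAt_slope_zero
  · exact (h.hasDerivAt_slope hr hr0).continuousAt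

theorem hasDerivAt_position (h : IsWell f f') (hr : r ∈ ampRange f) :
    HasDerivAt (position f) (slope f f' r) r := by
  rcases eq_or_ne r 0 with rfl | hr0
  · have hI := h.ampRange_mem_nhds zero_mem_ampRange
    -- `position` is differentiable near `0` except at `0`, where its derivative has a limit
    have hd : DifferentiableOn ℝ (position f) (ampRange f \ {0}) := fun x hx =>
      (h.hasDerivAt_position_of_ne hx.1 hx.2).differentiableAt.differentiableWithinAt
    have hlim : ∀ l : Filter ℝ, l ≤ 𝓝[≠] 0 →
        Tendsto (deriv (position f)) l (𝓝 (slope f f' 0)) := fun l hl => by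
      refine (h.continuousAt_slope_zero.tendsto.mono_left
        (hl.trans nhdsWithin_le_nhds)).congr' (hl ?_)
      filter_upwards [nhdsWithin_le_nhds hI, self_mem_nhdsWithin] with x hx hx0
      exact (h.hasDerivAt_position_of_ne hx hx0).deriv.symm
    have hc := (h.continuousAt_position zero_mem_ampRange)
    have hl := hasDerivWithinAt_Iic_of_tendsto_deriv (s := ampRange f ∩ Iio 0)
      (hd.mono fun x hx => ⟨hx.1, ne_of_lt hx.2⟩) hc.continuousWithinAt
      (inter_mem (nhdsWithin_le_nhds hI) self_mem_nhdsWithin)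
      (hlim _ (nhdsWithin_mono _ fun x hx => ne_of_lt hx))
    have hr := hasDerivWithinAt_Ici_of_tendsto_deriv (s := ampRange f ∩ Ioi 0)
      (hd.mono fun x hx => ⟨hx.1, ne_of_gt hx.2⟩) hc.continuousWithinAt
      (inter_mem (nhdsWithin_le_nhds hI) self_mem_nhdsWithin)
      (hlim _ (nhdsWithin_mono _ fun x hx => ne_of_gt hx))
    simpa using hl.union hr
  · exact h.hasDerivAt_position_of_ne hr hr0

end IsWell

namespace IsWell

/-! ### Periodic motions in a well, in polar coordinates -/

/-- The time that the motion of energy `ρ ^ 2 / 2` needs for the polar angle `θ` of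
`(p, r)` (velocity and amplitude coordinate) to grow from `0` to `θ`. -/
noncomputable def angleTime (f f' : ℝ → ℝ) (ρ θ : ℝ) : ℝ :=
  ∫ φ in (0 : ℝ)..θ, slope f f' (ρ * Real.sin φ)

/-- The minimal period of the motion of energy `ρ ^ 2 / 2`. -/
noncomputable def period (f f' : ℝ → ℝ) (ρ : ℝ) : ℝ := angleTime f f' ρ (2 * Real.pi)

variable {f f' : ℝ → ℝ} {r s t ρ θ : ℝ}

theorem mul_sin_mem_ampRange (h : IsWell f f') (hρ : ρ ∈ ampRange f) (hρ' : -ρ ∈ ampRange f) :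
    ρ * Real.sin θ ∈ ampRange f := by
  have h1 := Real.neg_one_le_sin θ
  have h2 := Real.sin_le_one θ
  rcases le_total 0 ρ with h0 | h0
  · exact h.ordConnected_ampRange.out hρ' hρ ⟨by nlinarith, by nlinarith⟩
  · exact h.ordConnected_ampRange.out hρ hρ' ⟨by nlinarith, by nlinarith⟩

theorem continuous_slope_mul_sin (h : IsWell f f') (hρ : ρ ∈ ampRange f)
    (hρ' : -ρ ∈ ampRange f) : Continuous fun φ => slope f f' (ρ * Real.sin φ) :=
  continuous_iff_continuousAt.2 fun _ =>
    ContinuousAt.comp (f := fun φ => ρ * Real.sin φ)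
      (h.continuousAt_slope (h.mul_sin_mem_ampRange hρ hρ')) (by fun_prop)

theorem hasDerivAt_angleTime (h : IsWell f f') (hρ : ρ ∈ ampRange f) (hρ' : -ρ ∈ ampRange f)
    (θ : ℝ) : HasDerivAt (angleTime f f' ρ) (slope f f' (ρ * Real.sin θ)) θ :=
  (h.continuous_slope_mul_sin hρ hρ').integral_hasStrictDerivAt 0 θ |>.hasDerivAt

theorem angleTime_add_two_pi (h : IsWell f f') (hρ : ρ ∈ ampRange f) (hρ' : -ρ ∈ ampRange f) :
    angleTime f f' ρ (θ + 2 * Real.pi) = angleTime f f' ρ θ + period f f' ρ := by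
  have hc := h.continuous_slope_mul_sin hρ hρ'
  have hp : Function.Periodic (fun φ => slope f f' (ρ * Real.sin φ)) (2 * Real.pi) := fun φ => by
    simp
  have := hp.intervalIntegral_add_eq θ 0
  rw [zero_add] at this
  rw [angleTime, angleTime, period, angleTime, ← this,
    intervalIntegral.integral_add_adjacent_intervals] <;> exact hc.intervalIntegrable _ _

theorem period_pos (h : IsWell f f') (hρ : ρ ∈ ampRange f) (hρ' : -ρ ∈ ampRange f) :
    0 < period f f' ρ := by
  have hmono : StrictMono (angleTime f f' ρ) :=
    strictMono_of_hasDerivAt_pos (h.hasDerivAt_angleTime hρ hρ') fun θ =>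
      h.slope_pos (h.mul_sin_mem_ampRange hρ hρ')
  have := hmono Real.two_pi_pos
  rwa [angleTime, intervalIntegral.integral_same] at this

/-- The polar angle as a function of time, along the motion that starts with angle `0`. -/
theorem exists_angle (h : IsWell f f') (hρ : ρ ∈ ampRange f) (hρ' : -ρ ∈ ampRange f) :
    ∃ Θ : ℝ → ℝ, StrictMono Θ ∧ Function.Surjective Θ ∧
      (∀ t, Θ (t + period f f' ρ) = Θ t + 2 * Real.pi) ∧
      ∀ t, HasDerivAt Θ (slope f f' (ρ * Real.sin (Θ t)))⁻¹ t := by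
  have hpos : ∀ θ, 0 < slope f f' (ρ * Real.sin θ) := fun θ =>
    h.slope_pos (h.mul_sin_mem_ampRange hρ hρ')
  have hd := h.hasDerivAt_angleTime hρ hρ'
  have hmono : StrictMono (angleTime f f' ρ) :=
    strictMono_of_hasDerivAt_pos hd hpos
  have hcont : Continuous (angleTime f f' ρ) :=
    continuous_iff_continuousAt.2 fun θ => (hd θ).continuousAt
  have hT := h.period_pos hρ hρ'
  have hnat : ∀ n : ℕ, angleTime f f' ρ (n * (2 * Real.pi)) = n * period f f' ρ ∧
      angleTime f f' ρ (-(n * (2 * Real.pi))) = -(n * period f f' ρ) := by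
    intro n
    induction n with
    | zero => simp [angleTime]
    | succ n ih =>
      constructor
      · rw [Nat.cast_succ, add_one_mul, h.angleTime_add_two_pi hρ hρ', ih.1]
        ring
      · have := h.angleTime_add_two_pi (θ := -((n + 1 : ℕ) * (2 * Real.pi))) hρ hρ'
        rw [show -((n + 1 : ℕ) * (2 * Real.pi)) + 2 * Real.pi = -(n * (2 * Real.pi)) by
          push_cast; ring, ih.2] at this
        push_cast at this ⊢
        linarith
  have hsurj : Function.Surjective (angleTime f f' ρ) := by
    intro t
    obtain ⟨n, hn⟩ := exists_nat_gt (|t| / period f f' ρ)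
    rw [div_lt_iff₀ hT] at hn
    have ht := abs_lt.1 hn
    have := intermediate_value_Icc (show -(n * (2 * Real.pi)) ≤ n * (2 * Real.pi) by
      have := Real.pi_pos
      have : (0 : ℝ) ≤ n * (2 * Real.pi) := by positivity
      linarith) hcont.continuousOn
    rw [(hnat n).1, (hnat n).2] at this
    obtain ⟨θ, -, hθ⟩ := this ⟨ht.1.le, ht.2.le⟩
    exact ⟨θ, hθ⟩
  let e := hmono.orderIsoOfSurjective _ hsurj
  have he : ∀ t, angleTime f f' ρ (e.symm t) = t := e.apply_symm_apply
  refine ⟨e.symm, e.symm.strictMono, e.symm.surjective, fun t => ?_, fun t => ?_⟩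
  · apply hmono.injective
    rw [he, h.angleTime_add_two_pi hρ hρ', he]
  · exact (hd _).of_local_left_inverse e.symm.continuous.continuousAt (hpos _).ne'
      (Eventually.of_forall he)

/-! ### The derivative of the period -/

theorem period_eq (h : IsWell f f') (hρ : ρ ∈ ampRange f) (hρ' : -ρ ∈ ampRange f) :
    period f f' ρ =
      2 * ∫ θ in (-(Real.pi / 2))..(Real.pi / 2), slope f f' (ρ * Real.sin θ) := by
  have hc := h.continuous_slope_mul_sin hρ hρ'
  have hp : Function.Periodic (fun φ => slope f f' (ρ * Real.sin φ)) (2 * Real.pi) := fun φ => by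
    simp
  have h1 := hp.intervalIntegral_add_eq 0 (-(Real.pi / 2))
  rw [zero_add] at h1
  rw [period, angleTime, h1, ← intervalIntegral.integral_add_adjacent_intervals
    (hc.intervalIntegrable _ (Real.pi / 2)) (hc.intervalIntegrable _ _)]
  have h2 := intervalIntegral.integral_comp_sub_left (a := -(Real.pi / 2)) (b := Real.pi / 2)
    (fun φ => slope f f' (ρ * Real.sin φ)) Real.pi
  simp only [Real.sin_pi_sub] at h2
  rw [show Real.pi - Real.pi / 2 = Real.pi / 2 by ring,
    show Real.pi - -(Real.pi / 2) = -(Real.pi / 2) + 2 * Real.pi by ring] at h2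
  linarith

theorem deriv_slope (h : IsWell f f') (hr : r ∈ ampRange f) (hr0 : r ≠ 0) :
    deriv (slope f f') r = curvature f f' r :=
  (h.hasDerivAt_slope hr hr0).deriv

theorem sin_ne_zero_of_mem (hθ : θ ∈ Icc (-(Real.pi / 2)) (Real.pi / 2)) (h0 : θ ≠ 0) :
    Real.sin θ ≠ 0 := by
  intro hs
  apply h0
  refine Real.injOn_sin hθ ⟨?_, ?_⟩ (by simpa using hs) <;> linarith [Real.pi_pos]

/-- Differentiation of the period under the integral sign. The integrand may fail to be
differentiable in `ρ` at the single angle `θ = 0`. -/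
theorem hasDerivAt_period (h : IsWell f f') {C : ℝ}
    (hC : ∀ r ∈ ampRange f, r ≠ 0 → |curvature f f' r| ≤ C)
    (hρ : ρ ∈ ampRange f) (hρ' : -ρ ∈ ampRange f) (hρ0 : 0 < ρ) :
    IntervalIntegrable (fun θ => deriv (slope f f') (ρ * Real.sin θ) * Real.sin θ) volume
        (-(Real.pi / 2)) (Real.pi / 2) ∧
      HasDerivAt (period f f') (2 * ∫ θ in (-(Real.pi / 2))..(Real.pi / 2),
        deriv (slope f f') (ρ * Real.sin θ) * Real.sin θ) ρ := by
  have hU : ∀ᶠ x in 𝓝 ρ, x ∈ ampRange f ∧ -x ∈ ampRange f ∧ 0 < x := by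
    filter_upwards [h.ampRange_mem_nhds hρ,
      continuous_neg.continuousAt.eventually_mem (h.ampRange_mem_nhds hρ'),
      Ioi_mem_nhds hρ0] with x h1 h2 h3 using ⟨h1, h2, h3⟩
  have hae : ∀ᵐ θ : ℝ, θ ≠ 0 := by simp [ae_iff]
  have hle : -(Real.pi / 2) ≤ Real.pi / 2 := by linarith [Real.pi_pos]
  have hsin : ∀ θ ∈ uIoc (-(Real.pi / 2)) (Real.pi / 2), θ ≠ 0 → Real.sin θ ≠ 0 := by
    intro θ hθ
    rw [uIoc_of_le hle] at hθ
    exact sin_ne_zero_of_mem ⟨hθ.1.le, hθ.2⟩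
  have key := intervalIntegral.hasDerivAt_integral_of_dominated_loc_of_deriv_le
    (μ := volume) (a := -(Real.pi / 2)) (b := Real.pi / 2) (x₀ := ρ) (bound := fun _ => C)
    (F := fun x θ => slope f f' (x * Real.sin θ))
    (F' := fun x θ => deriv (slope f f') (x * Real.sin θ) * Real.sin θ) hU
    (by
      filter_upwards [hU] with x hx
      exact (h.continuous_slope_mul_sin hx.1 hx.2.1).aestronglyMeasurable)
    ((h.continuous_slope_mul_sin hρ hρ').intervalIntegrable _ _)
    (by
      refine Measurable.aestronglyMeasurable ?_
      exact ((measurable_deriv _).comp (by fun_prop)).mul (by fun_prop))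
    (by
      filter_upwards [hae] with θ hθ hθ' x hx
      have hm := h.mul_sin_mem_ampRange (θ := θ) hx.1 hx.2.1
      have h0 : x * Real.sin θ ≠ 0 := mul_ne_zero hx.2.2.ne' (hsin θ hθ' hθ)
      rw [h.deriv_slope hm h0, norm_mul, Real.norm_eq_abs, Real.norm_eq_abs]
      have := hC _ hm h0
      exact (mul_le_of_le_one_right (abs_nonneg _) (Real.abs_sin_le_one θ)).trans this)
    intervalIntegrable_const
    (by
      filter_upwards [hae] with θ hθ hθ' x hx
      have hm := h.mul_sin_mem_ampRange (θ := θ) hx.1 hx.2.1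
      have h0 : x * Real.sin θ ≠ 0 := mul_ne_zero hx.2.2.ne' (hsin θ hθ' hθ)
      have hd := (h.hasDerivAt_slope hm h0).differentiableAt.hasDerivAt
      exact hd.comp x (hasDerivAt_mul_const _))
  refine ⟨key.1, ?_⟩
  refine (key.2.const_mul 2).congr_of_eventuallyEq ?_
  filter_upwards [hU] with x hx using h.period_eq hx.1 hx.2.1

/-- The left side is the integral of `r * curvature r` over `[-ρ, ρ]`, with the substitution
`r = ρ sin θ`; a primitive is `r * slope r - position r`. -/
theorem integral_curvature_mul_cos (h : IsWell f f') {C : ℝ}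
    (hC : ∀ r ∈ ampRange f, r ≠ 0 → |curvature f f' r| ≤ C)
    (hρ : ρ ∈ ampRange f) (hρ' : -ρ ∈ ampRange f) (hρ0 : 0 < ρ) :
    ∫ θ in (-(Real.pi / 2))..(Real.pi / 2),
        ρ ^ 2 * (deriv (slope f f') (ρ * Real.sin θ) * Real.sin θ) * Real.cos θ =
      (ρ * slope f f' ρ - position f ρ) + (ρ * slope f f' (-ρ) + position f (-ρ)) := by
  have hle : -(Real.pi / 2) ≤ Real.pi / 2 := by linarith [Real.pi_pos]
  have hi := (h.hasDerivAt_period hC hρ hρ' hρ0).1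
  have := integral_eq_of_hasDerivAt_off_countable_of_le
    (fun θ => ρ * Real.sin θ * slope f f' (ρ * Real.sin θ) - position f (ρ * Real.sin θ))
    (fun θ => ρ ^ 2 * (deriv (slope f f') (ρ * Real.sin θ) * Real.sin θ) * Real.cos θ)
    hle (countable_singleton 0) ?_ ?_ ((hi.const_mul (ρ ^ 2)).mul_continuousOn (by fun_prop))
  · rw [this]
    simp
    ring
  · refine Continuous.continuousOn (Continuous.sub ?_ ?_)
    · exact Continuous.mul (by fun_prop) (h.continuous_slope_mul_sin hρ hρ')
    · exact continuous_iff_continuousAt.2 fun _ =>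
        ContinuousAt.comp (f := fun φ => ρ * Real.sin φ)
          (h.continuousAt_position (h.mul_sin_mem_ampRange hρ hρ')) (by fun_prop)
  · rintro θ ⟨hθ, hθ0⟩
    have hm := h.mul_sin_mem_ampRange (θ := θ) hρ hρ'
    have h0 : ρ * Real.sin θ ≠ 0 :=
      mul_ne_zero hρ0.ne' (sin_ne_zero_of_mem (Ioo_subset_Icc_self hθ) hθ0)
    have hd := (h.hasDerivAt_slope hm h0).differentiableAt.hasDerivAt
    have hs : HasDerivAt (fun θ => ρ * Real.sin θ) (ρ * Real.cos θ) θ :=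
      (Real.hasDerivAt_sin θ).const_mul ρ
    refine ((hs.mul (hd.comp θ hs)).sub ((h.hasDerivAt_position hm).comp θ hs)).congr_deriv ?_
    simp only [Function.comp]
    ring

/-- If `r * curvature r` decays as the sum of two powers of `r`, then up to an error of that decay
the derivative of the period is given by boundary terms at the two turning points of the motion.
The reason is that the weight `1 - cos θ` in the remainder vanishes at `θ = 0` to the second order,
which more than compensates for the growth of the bound there. -/
theorem exists_hasDerivAt_period (h : IsWell f f') {C B e η : ℝ} (hB : 0 ≤ B) (he : 0 ≤ e)
    (hη : -1 ≤ η) (hC : ∀ r ∈ ampRange f, r ≠ 0 → |curvature f f' r| ≤ C)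
    (hdecay : ∀ r ∈ ampRange f, r ≠ 0 →
      |r| * |curvature f f' r| ≤ B * (e * |r| ^ (η - 1) + |r| ^ (-7 / 4 : ℝ)))
    (hρ : ρ ∈ ampRange f) (hρ' : -ρ ∈ ampRange f) (hρ0 : 0 < ρ) :
    ∃ T', HasDerivAt (period f f') T' ρ ∧
      |ρ ^ 2 * T' / 2 - ((ρ * slope f f' ρ - position f ρ) +
        (ρ * slope f f' (-ρ) + position f (-ρ)))| ≤
      Real.pi * B * (e * ρ ^ η + ρ ^ (-3 / 4 : ℝ)) := by
  obtain ⟨hi, hd⟩ := h.hasDerivAt_period hC hρ hρ' hρ0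
  refine ⟨_, hd, ?_⟩
  have hle : -(Real.pi / 2) ≤ Real.pi / 2 := by linarith [Real.pi_pos]
  rw [← h.integral_curvature_mul_cos hC hρ hρ' hρ0, mul_div_assoc,
    mul_div_cancel_left₀ _ two_ne_zero, ← intervalIntegral.integral_const_mul,
    ← intervalIntegral.integral_sub (hi.const_mul _)
      ((hi.const_mul (ρ ^ 2)).mul_continuousOn (by fun_prop))]
  have hbound : ∀ θ ∈ uIoc (-(Real.pi / 2)) (Real.pi / 2),
      ‖ρ ^ 2 * (deriv (slope f f') (ρ * Real.sin θ) * Real.sin θ) -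
        ρ ^ 2 * (deriv (slope f f') (ρ * Real.sin θ) * Real.sin θ) * Real.cos θ‖ ≤
      B * (e * ρ ^ η + ρ ^ (-3 / 4 : ℝ)) := by
    intro θ hθ
    rw [uIoc_of_le hle] at hθ
    rcases eq_or_ne θ 0 with rfl | hθ0
    · simp only [Real.sin_zero, mul_zero, zero_mul, sub_zero, norm_zero]
      positivity
    have hs := sin_ne_zero_of_mem ⟨hθ.1.le, hθ.2⟩ hθ0
    have hm := h.mul_sin_mem_ampRange (θ := θ) hρ hρ'
    have h0 : ρ * Real.sin θ ≠ 0 := mul_ne_zero hρ0.ne' hs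
    have hcos : 0 ≤ Real.cos θ := Real.cos_nonneg_of_mem_Icc ⟨hθ.1.le, hθ.2⟩
    have hcos1 := Real.cos_le_one θ
    set x := |Real.sin θ| with hx
    have hx0 : 0 < x := abs_pos.2 hs
    have hx1 : x ≤ 1 := Real.abs_sin_le_one θ
    have hxc : 1 - Real.cos θ ≤ x ^ 2 := by
      rw [hx, sq_abs, Real.sin_sq]
      nlinarith
    have hr : |ρ * Real.sin θ| = ρ * x := by rw [abs_mul, abs_of_pos hρ0]
    have hdec := hdecay _ hm h0
    rw [hr] at hdec
    rw [h.deriv_slope hm h0]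
    have e1 : ρ ^ 2 * (curvature f f' (ρ * Real.sin θ) * Real.sin θ) -
        ρ ^ 2 * (curvature f f' (ρ * Real.sin θ) * Real.sin θ) * Real.cos θ =
        ρ * (1 - Real.cos θ) * ((ρ * Real.sin θ) * curvature f f' (ρ * Real.sin θ)) := by ring
    rw [e1, Real.norm_eq_abs, abs_mul, abs_mul (ρ * Real.sin θ), hr,
      abs_of_nonneg (mul_nonneg hρ0.le (sub_nonneg.2 hcos1))]
    -- each power of `x` below has a nonnegative exponent once the weight is multiplied in
    have hpow : ∀ k : ℝ, -1 ≤ k → ρ * x ^ 2 * (ρ * x) ^ (k - 1) ≤ ρ ^ k := by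
      intro k hk
      rw [Real.mul_rpow hρ0.le hx0.le]
      have e2 : ρ * x ^ 2 * (ρ ^ (k - 1) * x ^ (k - 1)) = ρ ^ k * x ^ (k + 1) := by
        have h1 : ρ ^ k = ρ * ρ ^ (k - 1) := by
          rw [Real.rpow_sub_one hρ0.ne', mul_div_cancel₀ _ hρ0.ne']
        have h2 : x ^ (k + 1) = x ^ 2 * x ^ (k - 1) := by
          rw [← Real.rpow_natCast x 2, ← Real.rpow_add hx0]
          congr 1
          push_cast
          ring
        rw [h1, h2]
        ring
      rw [e2]
      exact mul_le_of_le_one_right (by positivity) (Real.rpow_le_one hx0.le hx1 (by linarith))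
    have h3 := hpow η hη
    have h4 := hpow (-3 / 4) (by norm_num)
    rw [show (-3 / 4 : ℝ) - 1 = -7 / 4 by norm_num] at h4
    calc ρ * (1 - Real.cos θ) * (ρ * x * |curvature f f' (ρ * Real.sin θ)|)
        ≤ ρ * x ^ 2 * (B * (e * (ρ * x) ^ (η - 1) + (ρ * x) ^ (-7 / 4 : ℝ))) := by gcongr
      _ = B * (e * (ρ * x ^ 2 * (ρ * x) ^ (η - 1)) + ρ * x ^ 2 * (ρ * x) ^ (-7 / 4 : ℝ)) := by
        ring
      _ ≤ B * (e * ρ ^ η + ρ ^ (-3 / 4 : ℝ)) := by gcongr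
  have := intervalIntegral.norm_integral_le_of_norm_le_const hbound
  rw [Real.norm_eq_abs, show Real.pi / 2 - -(Real.pi / 2) = Real.pi by ring,
    abs_of_pos Real.pi_pos] at this
  linarith

end IsWell

/-! ### A family of forces with a power-law wall -/

/-- The force (with the sign changed) of the family of potential wells to which the Loud systems
are reduced. For `η = 0` it is that of a harmonic oscillator on the half line, with a logarithmic
wall at `s = 0`. -/
noncomputable def wallForce (a c η s : ℝ) : ℝ :=
  a * s - (a - c) * s ^ η - c * s ^ (2 * η - 1)

/-- The derivative of `wallForce a c η`. -/
noncomputable def wallForceDeriv (a c η s : ℝ) : ℝ :=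
  a - (a - c) * (η * s ^ (η - 1)) - c * ((2 * η - 1) * s ^ (2 * η - 2))

/-- The second derivative of `wallForce a c η`. -/
noncomputable def wallForceDeriv2 (a c η s : ℝ) : ℝ :=
  -((a - c) * (η * ((η - 1) * s ^ (η - 2)))) -
    c * ((2 * η - 1) * ((2 * η - 2) * s ^ (2 * η - 3)))

/-- The bounds on the parameters of `wallForce` in terms of which all estimates are uniform. -/
structure WallBounds (κ Λ a c η : ℝ) : Prop where
  pos : 0 < κ
  one_le : 1 ≤ Λ
  le_a : κ ≤ a
  le_c : κ ≤ c
  a_le : a ≤ Λ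
  c_le : c ≤ Λ
  abs_eta_le : |η| ≤ 1 / 16

/-- Comparison of increments: a bound on the derivative by another derivative. -/
theorem abs_sub_le_sub_of_abs_deriv_le {u v u' v' : ℝ → ℝ} {x y : ℝ} (hxy : x ≤ y)
    (hu : ∀ t ∈ Icc x y, HasDerivAt u (u' t) t) (hv : ∀ t ∈ Icc x y, HasDerivAt v (v' t) t)
    (hle : ∀ t ∈ Icc x y, |u' t| ≤ v' t) : |u y - u x| ≤ v y - v x := by
  have key : ∀ ε : ℝ, |ε| = 1 → ε * (u y - u x) ≤ v y - v x := by
    intro ε hε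
    have hd : ∀ t ∈ Icc x y, HasDerivAt (fun t => v t - ε * u t) (v' t - ε * u' t) t :=
      fun t ht => (hv t ht).sub ((hu t ht).const_mul ε)
    have hm : MonotoneOn (fun t => v t - ε * u t) (Icc x y) := by
      refine monotoneOn_of_deriv_nonneg (convex_Icc x y)
        (fun t ht => (hd t ht).continuousAt.continuousWithinAt)
        (fun t ht => (hd t (interior_subset ht)).differentiableAt.differentiableWithinAt)
        fun t ht => ?_
      have ht' := interior_subset ht
      rw [(hd t ht').deriv, sub_nonneg]
      refine (le_abs_self _).trans ?_
      rw [abs_mul, hε, one_mul]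
      exact hle t ht'
    have := hm (left_mem_Icc.2 hxy) (right_mem_Icc.2 hxy) hxy
    simp only at this
    linarith
  refine abs_le.2 ⟨?_, ?_⟩
  · linarith [key (-1) (by simp)]
  · linarith [key 1 (by simp)]

theorem sub_le_sub_of_deriv_le {u v u' v' : ℝ → ℝ} {x y : ℝ} (hxy : x ≤ y)
    (hu : ∀ t ∈ Icc x y, HasDerivAt u (u' t) t) (hv : ∀ t ∈ Icc x y, HasDerivAt v (v' t) t)
    (hle : ∀ t ∈ Icc x y, u' t ≤ v' t) : u y - u x ≤ v y - v x := by
  have := abs_sub_le_sub_of_abs_deriv_le (u := fun _ => 0) (u' := fun _ => 0) hxy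
    (fun t _ => hasDerivAt_const t 0) (fun t ht => (hv t ht).sub (hu t ht))
    (fun t ht => by simpa using hle t ht)
  simp only [sub_self, abs_zero, Pi.sub_apply] at this
  linarith

theorem hasDerivAt_rpow_of_pos {s : ℝ} (hs : 0 < s) (p : ℝ) :
    HasDerivAt (fun x => x ^ p) (p * s ^ (p - 1)) s :=
  Real.hasDerivAt_rpow_const (Or.inl hs.ne')

theorem wallForce_eq {a c η s : ℝ} (hs : 0 < s) :
    wallForce a c η s = (s - s ^ η) * (a + c * s ^ (η - 1)) := by
  have h1 : s * s ^ (η - 1) = s ^ η := by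
    rw [Real.rpow_sub_one hs.ne', mul_div_cancel₀ _ hs.ne']
  have h2 : s ^ η * s ^ (η - 1) = s ^ (2 * η - 1) := by
    rw [← Real.rpow_add hs]
    congr 1
    ring
  rw [wallForce, ← h2]
  linear_combination (-c) * h1

theorem hasDerivAt_wallForce {a c η s : ℝ} (hs : 0 < s) :
    HasDerivAt (wallForce a c η) (wallForceDeriv a c η s) s := by
  have h1 := (hasDerivAt_rpow_of_pos hs η).const_mul (a - c)
  have h2 := (hasDerivAt_rpow_of_pos hs (2 * η - 1)).const_mul c
  rw [show 2 * η - 1 - 1 = 2 * η - 2 by ring] at h2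
  refine (((hasDerivAt_id s).const_mul a).sub h1 |>.sub h2).congr_deriv ?_
  rw [wallForceDeriv, mul_one]

theorem hasDerivAt_wallForceDeriv {a c η s : ℝ} (hs : 0 < s) :
    HasDerivAt (wallForceDeriv a c η) (wallForceDeriv2 a c η s) s := by
  have h1 := ((hasDerivAt_rpow_of_pos hs (η - 1)).const_mul η).const_mul (a - c)
  have h2 := ((hasDerivAt_rpow_of_pos hs (2 * η - 2)).const_mul (2 * η - 1)).const_mul c
  rw [show 2 * η - 2 - 1 = 2 * η - 3 by ring] at h2
  rw [show η - 1 - 1 = η - 2 by ring] at h1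
  exact ((h1.const_sub a).sub h2).congr_deriv rfl

namespace WallBounds

open IsWell

variable {κ Λ a c η s : ℝ}

theorem eta_le (h : WallBounds κ Λ a c η) : η ≤ 1 / 16 := (abs_le.1 h.abs_eta_le).2

theorem le_eta (h : WallBounds κ Λ a c η) : -(1 / 16) ≤ η := (abs_le.1 h.abs_eta_le).1

theorem a_pos (h : WallBounds κ Λ a c η) : 0 < a := h.pos.trans_le h.le_a

theorem c_pos (h : WallBounds κ Λ a c η) : 0 < c := h.pos.trans_le h.le_c

theorem Λ_pos (h : WallBounds κ Λ a c η) : 0 < Λ := one_pos.trans_le h.one_le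

theorem abs_sub_le (h : WallBounds κ Λ a c η) : |a - c| ≤ Λ := by
  have := h.a_pos
  have := h.c_pos
  exact abs_le.2 ⟨by linarith [h.c_le], by linarith [h.a_le]⟩

theorem sub_one_div_two_le (h : WallBounds κ Λ a c η) (hs : 1 ≤ s) : (s - 1) / 2 ≤ s - s ^ η := by
  have h1 : s ^ η ≤ √s := by
    rw [Real.sqrt_eq_rpow]
    exact Real.rpow_le_rpow_of_exponent_le hs (by linarith [h.eta_le])
  have h2 : √s ≤ (1 + s) / 2 := by
    rw [Real.sqrt_le_left (by linarith)]
    nlinarith [sq_nonneg (s - 1)]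
  linarith

theorem sub_rpow_le (h : WallBounds κ Λ a c η) (hs : 1 ≤ s) : s - s ^ η ≤ 2 * (s - 1) := by
  have hs0 : 0 < s := by linarith
  have h1 : s ^ (-1 : ℝ) ≤ s ^ η :=
    Real.rpow_le_rpow_of_exponent_le hs (by linarith [h.le_eta])
  have h2 : 2 - s ≤ s ^ (-1 : ℝ) := by
    rw [Real.rpow_neg_one, ← one_div, le_div_iff₀ hs0]
    nlinarith [sq_nonneg (s - 1)]
  linarith

theorem one_sub_div_two_le (h : WallBounds κ Λ a c η) (hs : 0 < s) (hs1 : s ≤ 1) :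
    s ^ η * ((1 - s) / 2) ≤ s ^ η - s := by
  have h1 : s ^ (1 - η) ≤ √s := by
    rw [Real.sqrt_eq_rpow]
    exact Real.rpow_le_rpow_of_exponent_ge hs hs1 (by linarith [h.eta_le])
  have h2 : √s ≤ (1 + s) / 2 := by
    rw [Real.sqrt_le_left (by linarith)]
    nlinarith [sq_nonneg (s - 1)]
  have h3 : s = s ^ η * s ^ (1 - η) := by
    rw [← Real.rpow_add hs, add_sub_cancel, Real.rpow_one]
  have h4 : 0 < s ^ η := by positivity
  nlinarith

theorem rpow_sub_le (h : WallBounds κ Λ a c η) (hs : 0 < s) (hs1 : s ≤ 1) :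
    s ^ η - s ≤ s ^ η * (2 * (1 - s)) := by
  have h1 : s ^ (2 : ℝ) ≤ s ^ (1 - η) :=
    Real.rpow_le_rpow_of_exponent_ge hs hs1 (by linarith [h.le_eta])
  rw [Real.rpow_two] at h1
  have h3 : s = s ^ η * s ^ (1 - η) := by
    rw [← Real.rpow_add hs, add_sub_cancel, Real.rpow_one]
  have h4 : 0 < s ^ η := by positivity
  have h5 : s ^ η * (2 * s - 1) ≤ s ^ η * s ^ (1 - η) := by
    refine mul_le_mul_of_nonneg_left ?_ h4.le
    nlinarith [sq_nonneg (s - 1)]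
  linarith

/-! ### Bounds on the force and the potential -/

theorem force_ge (h : WallBounds κ Λ a c η) (hs : 1 ≤ s) :
    κ * (s - 1) / 2 ≤ wallForce a c η s := by
  have hs0 : 0 < s := by linarith
  have h1 := h.sub_one_div_two_le hs
  have h2 : κ ≤ a + c * s ^ (η - 1) := by
    have := h.c_pos
    have : 0 ≤ c * s ^ (η - 1) := by positivity
    linarith [h.le_a]
  rw [wallForce_eq hs0]
  have := h.pos
  calc κ * (s - 1) / 2 = (s - 1) / 2 * κ := by ring
    _ ≤ _ := mul_le_mul h1 h2 this.le (by linarith)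

theorem force_le (h : WallBounds κ Λ a c η) (hs : 1 ≤ s) :
    wallForce a c η s ≤ 4 * Λ * (s - 1) := by
  have hs0 : 0 < s := by linarith
  have h1 := h.sub_rpow_le hs
  have h2 : a + c * s ^ (η - 1) ≤ 2 * Λ := by
    have h3 : s ^ (η - 1) ≤ 1 := Real.rpow_le_one_of_one_le_of_nonpos hs (by linarith [h.eta_le])
    have := mul_le_of_le_one_right h.c_pos.le h3
    linarith [h.a_le, h.c_le]
  have h4 : 0 ≤ a + c * s ^ (η - 1) := by
    have := h.c_pos
    have := h.a_pos
    positivity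
  rw [wallForce_eq hs0]
  calc _ ≤ 2 * (s - 1) * (2 * Λ) := mul_le_mul h1 h2 h4 (by linarith)
    _ = _ := by ring

theorem neg_force_ge (h : WallBounds κ Λ a c η) (hs : 0 < s) (hs1 : s ≤ 1) :
    κ / 2 * (1 - s) * s ^ (2 * η - 1) ≤ -wallForce a c η s := by
  have h1 := h.one_sub_div_two_le hs hs1
  have ha := h.a_pos
  have hc := h.c_pos
  have hp : 0 < s ^ (η - 1) := by positivity
  have h2 : κ * s ^ (η - 1) ≤ a + c * s ^ (η - 1) := by
    have := mul_le_mul_of_nonneg_right h.le_c hp.le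
    linarith
  have h3 : s ^ (2 * η - 1) = s ^ η * s ^ (η - 1) := by
    rw [← Real.rpow_add hs]
    congr 1
    ring
  have h4 : 0 ≤ s ^ η * ((1 - s) / 2) := mul_nonneg (by positivity) (by linarith)
  have hκ := h.pos
  rw [wallForce_eq hs, h3]
  calc _ = s ^ η * ((1 - s) / 2) * (κ * s ^ (η - 1)) := by ring
    _ ≤ (s ^ η - s) * (a + c * s ^ (η - 1)) :=
      mul_le_mul h1 h2 (by positivity) (h4.trans h1)
    _ = _ := by ring

theorem neg_force_le (h : WallBounds κ Λ a c η) (hs : 0 < s) (hs1 : s ≤ 1) :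
    -wallForce a c η s ≤ 4 * Λ * (1 - s) * s ^ (2 * η - 1) := by
  have h1 := h.rpow_sub_le hs hs1
  have ha := h.a_pos
  have hc := h.c_pos
  have hp : 1 ≤ s ^ (η - 1) :=
    Real.one_le_rpow_of_pos_of_le_one_of_nonpos hs hs1 (by linarith [h.eta_le])
  have h2 : a + c * s ^ (η - 1) ≤ 2 * Λ * s ^ (η - 1) := by
    have := h.c_le
    have := h.a_le
    nlinarith
  have h3 : s ^ (2 * η - 1) = s ^ η * s ^ (η - 1) := by
    rw [← Real.rpow_add hs]
    congr 1
    ring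
  rw [wallForce_eq hs, h3]
  calc _ = (s ^ η - s) * (a + c * s ^ (η - 1)) := by ring
    _ ≤ s ^ η * (2 * (1 - s)) * (2 * Λ * s ^ (η - 1)) :=
      mul_le_mul h1 h2 (by positivity) (mul_nonneg (by positivity) (by linarith))
    _ = _ := by ring

theorem isWell (h : WallBounds κ Λ a c η) :
    IsWell (wallForce a c η) (wallForceDeriv a c η) where
  hasDerivAt _ hs := hasDerivAt_wallForce hs
  continuousOn_deriv _ hs := (hasDerivAt_wallForceDeriv hs).continuousAt.continuousWithinAt
  pos s hs := by
    have hκ := h.pos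
    have : 0 < s - 1 := by linarith
    exact lt_of_lt_of_le (by positivity) (h.force_ge hs.le)
  neg s hs hs1 := by
    have hκ := h.pos
    have : 0 < 1 - s := by linarith
    have : 0 < -wallForce a c η s := lt_of_lt_of_le (by positivity) (h.neg_force_ge hs hs1.le)
    linarith
  deriv_pos := by
    have : wallForceDeriv a c η 1 = (a + c) * (1 - η) := by
      simp only [wallForceDeriv, Real.one_rpow]
      ring
    rw [this]
    exact mul_pos (add_pos h.a_pos h.c_pos) (by linarith [h.eta_le])

theorem pot_ge (h : WallBounds κ Λ a c η) (hs : 1 ≤ s) :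
    κ / 4 * (s - 1) ^ 2 ≤ pot (wallForce a c η) s := by
  have := sub_le_sub_of_deriv_le (u := fun t => κ / 4 * (t - 1) ^ 2)
    (u' := fun t => κ * (t - 1) / 2) hs (fun t _ => by
      refine ((((hasDerivAt_id t).sub_const 1).fun_pow 2).const_mul (κ / 4)).congr_deriv ?_
      simp only [id]
      ring)
    (fun t ht => h.isWell.hasDerivAt_pot (one_pos.trans_le ht.1)) fun t ht => h.force_ge ht.1
  simpa using this

theorem pot_le (h : WallBounds κ Λ a c η) (hs : 1 ≤ s) :
    pot (wallForce a c η) s ≤ 2 * Λ * (s - 1) ^ 2 := by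
  have := sub_le_sub_of_deriv_le (v := fun t => 2 * Λ * (t - 1) ^ 2)
    (v' := fun t => 4 * Λ * (t - 1)) hs
    (fun t ht => h.isWell.hasDerivAt_pot (one_pos.trans_le ht.1)) (fun t _ => by
      refine ((((hasDerivAt_id t).sub_const 1).fun_pow 2).const_mul (2 * Λ)).congr_deriv ?_
      simp only [id]
      ring) fun t ht => h.force_le ht.1
  simpa using this

theorem rpow_le_of_le_one (h : WallBounds κ Λ a c η) (hs : 0 < s) (hs1 : s ≤ 1) :
    s ^ (2 * η - 1) ≤ s ^ (-9 / 8 : ℝ) :=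
  Real.rpow_le_rpow_of_exponent_ge hs hs1 (by linarith [h.le_eta])

theorem pot_le_of_le_one (h : WallBounds κ Λ a c η) (hs : 0 < s) (hs1 : s ≤ 1) :
    pot (wallForce a c η) s ≤ 32 * Λ * s ^ (-1 / 8 : ℝ) := by
  have hΛ := h.Λ_pos
  have := sub_le_sub_of_deriv_le (u := fun t => 32 * Λ * t ^ (-1 / 8 : ℝ))
    (u' := fun t => -(4 * Λ * t ^ (-9 / 8 : ℝ))) hs1 (fun t ht => by
      refine ((hasDerivAt_rpow_of_pos (hs.trans_le ht.1) (-1 / 8)).const_mul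
        (32 * Λ)).congr_deriv ?_
      rw [show (-1 / 8 : ℝ) - 1 = -9 / 8 by norm_num]
      ring)
    (fun t ht => h.isWell.hasDerivAt_pot (hs.trans_le ht.1)) fun t ht => by
      have ht0 := hs.trans_le ht.1
      have h1 := h.neg_force_le ht0 ht.2
      have h2 := h.rpow_le_of_le_one ht0 ht.2
      have h3 : 4 * Λ * (1 - t) * t ^ (2 * η - 1) ≤ 4 * Λ * t ^ (-9 / 8 : ℝ) := by
        refine mul_le_mul ?_ h2 (by positivity) (by positivity)
        exact mul_le_of_le_one_right (by positivity) (by linarith)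
      linarith
  rw [pot_one, Real.one_rpow] at this
  linarith

theorem pot_le_of_half_le (h : WallBounds κ Λ a c η) (hs : 1 / 2 ≤ s) (hs1 : s ≤ 1) :
    pot (wallForce a c η) s ≤ 8 * Λ * (1 - s) ^ 2 := by
  have hΛ := h.Λ_pos
  have := sub_le_sub_of_deriv_le (u := fun t => 8 * Λ * (1 - t) ^ 2)
    (u' := fun t => -(16 * Λ * (1 - t))) hs1 (fun t ht => by
      refine ((((hasDerivAt_id t).const_sub 1).fun_pow 2).const_mul (8 * Λ)).congr_deriv ?_
      simp only [id]
      ring)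
    (fun t ht => h.isWell.hasDerivAt_pot (by linarith [ht.1])) fun t ht => by
      have ht2 : 1 / 2 ≤ t := hs.trans ht.1
      have ht0 : 0 < t := by linarith
      have h1 := h.neg_force_le ht0 ht.2
      have h2 : t ^ (2 * η - 1) ≤ 4 := by
        calc t ^ (2 * η - 1) ≤ t ^ (-2 : ℝ) :=
              Real.rpow_le_rpow_of_exponent_ge ht0 ht.2 (by linarith [h.le_eta])
          _ ≤ (1 / 2 : ℝ) ^ (-2 : ℝ) :=
              Real.rpow_le_rpow_of_nonpos (by norm_num) ht2 (by norm_num)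
          _ = 4 := by
              rw [Real.rpow_neg (by norm_num), Real.rpow_two]
              norm_num
      have h3 : 4 * Λ * (1 - t) * t ^ (2 * η - 1) ≤ 4 * Λ * (1 - t) * 4 :=
        mul_le_mul_of_nonneg_left h2 (mul_nonneg (by positivity) (by linarith [ht.2]))
      linarith
  simp only [pot_one, sub_self] at this
  linarith

/-- The wall is high: for `η ≤ 0` the potential is infinite at `0`, and for a small positive `η`
it is finite there but still large. -/
theorem pot_exp_ge (h : WallBounds κ Λ a c η) {k : ℝ} (hk : 0 ≤ k) (hkη : |η| * k ≤ 1 / 4) :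
    κ / 4 * (k / 2 - 2) ≤ pot (wallForce a c η) (Real.exp (-k)) := by
  have hκ := h.pos
  have hs1 : Real.exp (-k) ≤ 1 := Real.exp_le_one_iff.2 (by linarith)
  have := sub_le_sub_of_deriv_le (v := fun t => κ / 4 * (2 * t - (1 / 2) * Real.log t))
    (v' := fun t => κ / 4 * (2 - (1 / 2) * t⁻¹)) hs1
    (fun t ht => h.isWell.hasDerivAt_pot ((Real.exp_pos _).trans_le ht.1)) (fun t ht => by
      have ht0 : t ≠ 0 := ((Real.exp_pos _).trans_le ht.1).ne'
      refine ((((hasDerivAt_id t).const_mul 2).sub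
        ((Real.hasDerivAt_log ht0).const_mul (1 / 2))).const_mul (κ / 4)).congr_deriv ?_
      simp) fun t ht => by
      have ht0 : 0 < t := (Real.exp_pos _).trans_le ht.1
      have h1 := h.neg_force_ge ht0 ht.2
      have hl : -k ≤ Real.log t := (Real.le_log_iff_exp_le ht0).2 ht.1
      have hl' : Real.log t ≤ 0 := Real.log_nonpos ht0.le ht.2
      have h2 : 1 / 2 * t⁻¹ ≤ t ^ (2 * η - 1) := by
        rw [Real.rpow_sub_one ht0.ne', div_eq_mul_inv]
        refine mul_le_mul_of_nonneg_right ?_ (by positivity)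
        rw [Real.rpow_def_of_pos ht0]
        have : -(1 / 4) ≤ η * Real.log t := by
          have : |η * Real.log t| ≤ 1 / 4 := by
            rw [abs_mul]
            refine (mul_le_mul_of_nonneg_left ?_ (abs_nonneg η)).trans hkη
            exact abs_le.2 ⟨hl, by linarith⟩
          exact (abs_le.1 this).1
        linarith [Real.add_one_le_exp (Real.log t * (2 * η))]
      have h3 : κ / 2 * (1 - t) * (1 / 2 * t⁻¹) ≤ κ / 2 * (1 - t) * t ^ (2 * η - 1) :=
        mul_le_mul_of_nonneg_left h2 (mul_nonneg (by positivity) (by linarith [ht.2]))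
      have h4 : κ / 2 * (1 - t) * (1 / 2 * t⁻¹) = κ / 4 * t⁻¹ - κ / 4 := by
        field_simp
        ring
      have h5 : 0 < κ * t⁻¹ := by positivity
      linarith
  rw [pot_one, Real.log_exp, Real.log_one] at this
  have := mul_pos hκ (Real.exp_pos (-k))
  linarith

/-! ### Bounds on the curvature -/

theorem abs_deriv_le (h : WallBounds κ Λ a c η) (hs : 0 < s) (hs1 : s ≤ 1) :
    |wallForceDeriv a c η s| ≤ 3 * Λ * s ^ (2 * η - 2) := by
  have hΛ := h.Λ_pos
  have hp : 1 ≤ s ^ (2 * η - 2) :=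
    Real.one_le_rpow_of_pos_of_le_one_of_nonpos hs hs1 (by linarith [h.eta_le])
  have hq : s ^ (η - 1) ≤ s ^ (2 * η - 2) :=
    Real.rpow_le_rpow_of_exponent_ge hs hs1 (by linarith [h.eta_le])
  have hq0 : 0 < s ^ (η - 1) := by positivity
  have h1 : |(a - c) * (η * s ^ (η - 1))| ≤ Λ * (1 / 16 * s ^ (2 * η - 2)) := by
    rw [abs_mul, abs_mul, abs_of_pos hq0]
    exact mul_le_mul h.abs_sub_le (mul_le_mul h.abs_eta_le hq hq0.le (by norm_num))
      (by positivity) hΛ.le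
  have h2 : |c * ((2 * η - 1) * s ^ (2 * η - 2))| ≤ Λ * (9 / 8 * s ^ (2 * η - 2)) := by
    rw [abs_mul, abs_mul, abs_of_pos h.c_pos, abs_of_pos (zero_lt_one.trans_le hp)]
    refine mul_le_mul h.c_le (mul_le_mul_of_nonneg_right ?_ (by positivity))
      (by positivity) hΛ.le
    exact abs_le.2 ⟨by linarith [h.le_eta], by linarith [h.eta_le]⟩
  have h3 : |a| ≤ Λ * s ^ (2 * η - 2) := by
    rw [abs_of_pos h.a_pos]
    exact h.a_le.trans (le_mul_of_one_le_right hΛ.le hp)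
  have h4 := abs_sub (a - (a - c) * (η * s ^ (η - 1))) (c * ((2 * η - 1) * s ^ (2 * η - 2)))
  have h5 := abs_sub a ((a - c) * (η * s ^ (η - 1)))
  have h6 : 0 < Λ * s ^ (2 * η - 2) := by positivity
  rw [wallForceDeriv]
  linarith

theorem abs_deriv2_le (h : WallBounds κ Λ a c η) (hs : 0 < s) :
    |wallForceDeriv2 a c η s| ≤ 3 * Λ * (|η| * s ^ (η - 2) + s ^ (2 * η - 3)) := by
  have hΛ := h.Λ_pos
  have hp : 0 < s ^ (η - 2) := by positivity
  have hq : 0 < s ^ (2 * η - 3) := by positivity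
  have h1 : |(a - c) * (η * ((η - 1) * s ^ (η - 2)))| ≤ Λ * (|η| * (2 * s ^ (η - 2))) := by
    rw [abs_mul, abs_mul, abs_mul, abs_of_pos hp]
    have : |η - 1| ≤ 2 := abs_le.2 ⟨by linarith [h.le_eta], by linarith [h.eta_le]⟩
    exact mul_le_mul h.abs_sub_le (by gcongr) (by positivity) hΛ.le
  have h2 : |c * ((2 * η - 1) * ((2 * η - 2) * s ^ (2 * η - 3)))| ≤
      Λ * (3 * s ^ (2 * η - 3)) := by
    rw [abs_mul, abs_of_pos h.c_pos, ← mul_assoc, abs_mul, abs_of_pos hq]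
    have : |(2 * η - 1) * (2 * η - 2)| ≤ 3 := by
      have := h.le_eta
      have := h.eta_le
      exact abs_le.2 ⟨by nlinarith, by nlinarith⟩
    exact mul_le_mul h.c_le (by gcongr) (by positivity) hΛ.le
  have h3 := abs_sub (-((a - c) * (η * ((η - 1) * s ^ (η - 2)))))
    (c * ((2 * η - 1) * ((2 * η - 2) * s ^ (2 * η - 3))))
  rw [abs_neg] at h3
  have h4 : 0 ≤ Λ * (|η| * s ^ (η - 2)) := by positivity
  rw [wallForceDeriv2]
  linarith

end WallBounds

/-- The numerator `f ^ 2 - 2 W f'` of the curvature, where `W` is the potential of `f`. -/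
noncomputable def wallNumerator (a c η s : ℝ) : ℝ :=
  wallForce a c η s ^ 2 - 2 * IsWell.pot (wallForce a c η) s * wallForceDeriv a c η s

namespace WallBounds

open IsWell

variable {κ Λ a c η s : ℝ}

/-- The first derivative of the force cancels in the derivative of the numerator; this is why the
numerator vanishes at `1` to the third order, and grows slowly for large `s`. -/
theorem hasDerivAt_numerator (h : WallBounds κ Λ a c η) (hs : 0 < s) :
    HasDerivAt (wallNumerator a c η)
      (-(2 * pot (wallForce a c η) s * wallForceDeriv2 a c η s)) s := by
  refine (((hasDerivAt_wallForce hs).fun_pow 2).sub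
    (((h.isWell.hasDerivAt_pot hs).const_mul 2).mul (hasDerivAt_wallForceDeriv hs))).congr_deriv ?_
  simp only [Nat.cast_ofNat, Nat.add_one_sub_one, pow_one]
  ring

theorem numerator_one (h : WallBounds κ Λ a c η) : wallNumerator a c η 1 = 0 := by
  simp [wallNumerator, h.isWell.map_one]

theorem abs_numerator_le_cube (h : WallBounds κ Λ a c η) (hs : 1 ≤ s) :
    |wallNumerator a c η s| ≤ 8 * Λ ^ 2 * (s - 1) ^ 3 := by
  have hΛ := h.Λ_pos
  have := abs_sub_le_sub_of_abs_deriv_le (v := fun t => 8 * Λ ^ 2 * (t - 1) ^ 3)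
    (v' := fun t => 24 * Λ ^ 2 * (t - 1) ^ 2) hs
    (fun t ht => h.hasDerivAt_numerator (one_pos.trans_le ht.1)) (fun t _ => by
      refine ((((hasDerivAt_id t).sub_const 1).fun_pow 3).const_mul (8 * Λ ^ 2)).congr_deriv ?_
      simp only [id, Nat.cast_ofNat, Nat.add_one_sub_one]
      ring) fun t ht => by
      have ht0 : 0 < t := one_pos.trans_le ht.1
      have h1 := h.pot_le ht.1
      have h2 := h.abs_deriv2_le ht0
      have h3 : t ^ (η - 2) ≤ 1 :=
        Real.rpow_le_one_of_one_le_of_nonpos ht.1 (by linarith [h.eta_le])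
      have h4 : t ^ (2 * η - 3) ≤ 1 :=
        Real.rpow_le_one_of_one_le_of_nonpos ht.1 (by linarith [h.eta_le])
      have h5 : |η| * t ^ (η - 2) ≤ 1 := by
        have := h.abs_eta_le
        have := abs_nonneg η
        exact mul_le_one₀ (by linarith) (by positivity) h3
      have h0 := h.isWell.pot_nonneg ht0
      rw [abs_neg, abs_mul, abs_mul, abs_two, abs_of_nonneg h0]
      calc _ ≤ 2 * (2 * Λ * (t - 1) ^ 2) * (3 * Λ * (1 + 1)) := by
            refine mul_le_mul (by linarith) (h2.trans ?_) (abs_nonneg _) (by positivity)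
            gcongr
        _ = _ := by ring
  simpa [h.numerator_one] using this

theorem abs_numerator_le_rpow (h : WallBounds κ Λ a c η) (hs : 1 ≤ s) :
    |wallNumerator a c η s| ≤ 48 * Λ ^ 2 * (|η| * s ^ (1 + η) + s ^ (1 / 4 : ℝ)) := by
  have hΛ := h.Λ_pos
  have hη : 0 < 1 + η := by linarith [h.le_eta]
  have hs0 : 0 < s := one_pos.trans_le hs
  have := abs_sub_le_sub_of_abs_deriv_le
    (v := fun t => 12 * Λ ^ 2 * (|η| * (t ^ (1 + η) / (1 + η)) + 4 * t ^ (1 / 4 : ℝ)))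
    (v' := fun t => 12 * Λ ^ 2 * (|η| * t ^ η + t ^ (-3 / 4 : ℝ))) hs
    (fun t ht => h.hasDerivAt_numerator (one_pos.trans_le ht.1)) (fun t ht => by
      have ht0 : 0 < t := one_pos.trans_le ht.1
      refine (((((hasDerivAt_rpow_of_pos ht0 (1 + η)).div_const (1 + η)).const_mul |η|).add
        ((hasDerivAt_rpow_of_pos ht0 (1 / 4)).const_mul 4)).const_mul
          (12 * Λ ^ 2)).congr_deriv ?_
      rw [add_sub_cancel_left, show (1 / 4 : ℝ) - 1 = -3 / 4 by norm_num]
      field_simp) fun t ht => by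
      have ht0 : 0 < t := one_pos.trans_le ht.1
      have h1 : pot (wallForce a c η) t ≤ 2 * Λ * t ^ 2 := by
        refine (h.pot_le ht.1).trans ?_
        have := ht.1
        gcongr
        linarith
      have h2 := h.abs_deriv2_le ht0
      have h3 : t ^ 2 * t ^ (η - 2) = t ^ η := by
        rw [← Real.rpow_natCast t 2, ← Real.rpow_add ht0]
        congr 1
        push_cast
        ring
      have h4 : t ^ 2 * t ^ (2 * η - 3) ≤ t ^ (-3 / 4 : ℝ) := by
        rw [← Real.rpow_natCast t 2, ← Real.rpow_add ht0]
        refine Real.rpow_le_rpow_of_exponent_le ht.1 ?_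
        push_cast
        linarith [h.eta_le]
      have h0 := h.isWell.pot_nonneg ht0
      rw [abs_neg, abs_mul, abs_mul, abs_two, abs_of_nonneg h0]
      calc _ ≤ 2 * (2 * Λ * t ^ 2) * (3 * Λ * (|η| * t ^ (η - 2) + t ^ (2 * η - 3))) :=
            mul_le_mul (by linarith) h2 (abs_nonneg _) (by positivity)
        _ = 12 * Λ ^ 2 * (|η| * (t ^ 2 * t ^ (η - 2)) + t ^ 2 * t ^ (2 * η - 3)) := by ring
        _ ≤ _ := by
          rw [h3]
          gcongr
  rw [h.numerator_one, sub_zero] at this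
  simp only [Real.one_rpow] at this
  have h1 : s ^ (1 + η) / (1 + η) ≤ 4 * s ^ (1 + η) := by
    rw [div_le_iff₀ hη]
    have : 0 < s ^ (1 + η) := by positivity
    nlinarith [h.le_eta]
  have h2 : |η| * (s ^ (1 + η) / (1 + η)) ≤ |η| * (4 * s ^ (1 + η)) :=
    mul_le_mul_of_nonneg_left h1 (abs_nonneg η)
  have h3 : 0 ≤ |η| * (1 / (1 + η)) := by positivity
  have h4 : 12 * Λ ^ 2 * (|η| * (s ^ (1 + η) / (1 + η)) + 4 * s ^ (1 / 4 : ℝ)) ≤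
      12 * Λ ^ 2 * (|η| * (4 * s ^ (1 + η)) + 4 * s ^ (1 / 4 : ℝ)) := by gcongr
  have h5 : 0 ≤ 12 * Λ ^ 2 * (|η| * (1 / (1 + η)) + 4 * 1) := by positivity
  linarith

theorem abs_numerator_le_cube_of_le_one (h : WallBounds κ Λ a c η) (hs : 1 / 2 ≤ s)
    (hs1 : s ≤ 1) : |wallNumerator a c η s| ≤ 512 * Λ ^ 2 * (1 - s) ^ 3 := by
  have hΛ := h.Λ_pos
  have := abs_sub_le_sub_of_abs_deriv_le (v := fun t => -(512 * Λ ^ 2 * (1 - t) ^ 3))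
    (v' := fun t => 1536 * Λ ^ 2 * (1 - t) ^ 2) hs1
    (fun t ht => h.hasDerivAt_numerator (by linarith [ht.1])) (fun t _ => by
      refine ((((hasDerivAt_id t).const_sub 1).fun_pow 3).const_mul
        (512 * Λ ^ 2)).fun_neg.congr_deriv ?_
      simp only [id, Nat.cast_ofNat, Nat.add_one_sub_one]
      ring) fun t ht => by
      have ht2 : 1 / 2 ≤ t := hs.trans ht.1
      have ht0 : 0 < t := by linarith
      have h1 := h.pot_le_of_half_le ht2 ht.2
      have h2 := h.abs_deriv2_le ht0
      have h4 : ∀ p : ℝ, -4 ≤ p → t ^ p ≤ 16 := fun p hp => by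
        calc t ^ p ≤ t ^ (-4 : ℝ) :=
              Real.rpow_le_rpow_of_exponent_ge ht0 ht.2 hp
          _ ≤ (1 / 2 : ℝ) ^ (-4 : ℝ) :=
              Real.rpow_le_rpow_of_nonpos (by norm_num) ht2 (by norm_num)
          _ = 16 := by
              rw [Real.rpow_neg (by norm_num), show (4 : ℝ) = (4 : ℕ) by norm_num,
                Real.rpow_natCast]
              norm_num
      have h3 := h4 (η - 2) (by linarith [h.le_eta])
      have h5 := h4 (2 * η - 3) (by linarith [h.le_eta])
      have h6 : |η| * t ^ (η - 2) ≤ 1 / 16 * 16 :=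
        mul_le_mul h.abs_eta_le h3 (by positivity) (by norm_num)
      have h0 := h.isWell.pot_nonneg ht0
      rw [abs_neg, abs_mul, abs_mul, abs_two, abs_of_nonneg h0]
      calc _ ≤ 2 * (8 * Λ * (1 - t) ^ 2) * (3 * Λ * (1 / 16 * 16 + 16)) := by
            refine mul_le_mul (by linarith) (h2.trans ?_) (abs_nonneg _) (by positivity)
            gcongr
        _ ≤ _ := by nlinarith [mul_nonneg (sq_nonneg Λ) (sq_nonneg (1 - t))]
  rw [h.numerator_one, zero_sub, abs_neg] at this
  simp only [sub_self] at this
  linarith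

end WallBounds

theorem rpow_le_sq_mul_rpow {x y L p : ℝ} (hy : 0 < y) (hL : 1 ≤ L) (h : y ≤ L * x)
    (hp : -2 ≤ p) (hp0 : p ≤ 0) : x ^ p ≤ L ^ 2 * y ^ p := by
  have hL0 : 0 < L := by linarith
  have hx : 0 < x := by
    by_contra hx
    nlinarith
  have h1 : (L * x) ^ p ≤ y ^ p := Real.rpow_le_rpow_of_nonpos hy h hp0
  rw [Real.mul_rpow hL0.le hx.le] at h1
  have h2 : 1 ≤ L ^ 2 * L ^ p := by
    rw [← Real.rpow_natCast L 2, ← Real.rpow_add hL0]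
    exact Real.one_le_rpow hL (by push_cast; linarith)
  have h3 : 0 < x ^ p := by positivity
  calc x ^ p ≤ L ^ 2 * L ^ p * x ^ p := le_mul_of_one_le_left h3.le h2
    _ = L ^ 2 * (L ^ p * x ^ p) := by ring
    _ ≤ _ := by gcongr

theorem le_cube_mul_rpow {r R : ℝ} (hr : 0 < r) (hR : 1 ≤ R) (h : r ≤ R) :
    r ≤ R ^ 3 * r ^ (-7 / 4 : ℝ) := by
  have h1 : R ^ (-7 / 4 : ℝ) ≤ r ^ (-7 / 4 : ℝ) :=
    Real.rpow_le_rpow_of_nonpos hr h (by norm_num)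
  have h2 : R ^ (-2 : ℝ) ≤ R ^ (-7 / 4 : ℝ) :=
    Real.rpow_le_rpow_of_exponent_le hR (by norm_num)
  have h3 : R ^ 3 * R ^ (-2 : ℝ) = R := by
    have : 0 < R := by linarith
    rw [Real.rpow_neg this.le, Real.rpow_two]
    field_simp
  calc r ≤ R ^ 3 * R ^ (-2 : ℝ) := h.trans_eq h3.symm
    _ ≤ _ := by gcongr; exact h2.trans h1

namespace WallBounds

open IsWell

variable {κ Λ a c η s r ρ : ℝ}

theorem curvature_eq (h : WallBounds κ Λ a c η) (hr : r ∈ ampRange (wallForce a c η)) :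
    curvature (wallForce a c η) (wallForceDeriv a c η) r =
      wallNumerator a c η (position (wallForce a c η) r) /
        wallForce a c η (position (wallForce a c η) r) ^ 3 := by
  rw [curvature, wallNumerator, h.isWell.two_mul_pot_position hr]

theorem abs_div_cube_le {N F n g : ℝ} (hN : |N| ≤ n) (hg : 0 < g) (hF : g ≤ |F|) :
    |N / F ^ 3| ≤ n / g ^ 3 := by
  rw [abs_div, abs_pow]
  have : 0 ≤ n := (abs_nonneg N).trans hN
  gcongr

/-- Large motions: the coordinate `r` grows linearly with the position. -/
theorem le_mul_position_sub_one (h : WallBounds κ Λ a c η)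
    (hr : r ∈ ampRange (wallForce a c η)) (hr0 : 0 < r) :
    r ≤ 2 * Λ * (position (wallForce a c η) r - 1) := by
  have hΛ := h.one_le
  have hs := h.isWell.one_lt_position hr hr0
  have h1 := h.isWell.two_mul_pot_position hr
  have h2 := h.pot_le hs.le
  set s := position (wallForce a c η) r
  have h4 : 0 < s - 1 := by linarith
  refine abs_le_of_sq_le_sq' ?_ (by positivity) |>.2
  nlinarith [mul_nonneg (sub_nonneg.2 hΛ) (mul_nonneg (by linarith : 0 ≤ Λ) (sq_nonneg (s - 1)))]

theorem position_le_mul (h : WallBounds κ Λ a c η) (hr : r ∈ ampRange (wallForce a c η))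
    (hr0 : 0 < r) (hs : 2 ≤ position (wallForce a c η) r) :
    position (wallForce a c η) r ≤ (1 + 8 / κ) * r := by
  have hκ := h.pos
  have h1 := h.isWell.two_mul_pot_position hr
  have h2 := h.pot_ge (by linarith : 1 ≤ position (wallForce a c η) r)
  set s := position (wallForce a c η) r
  have h3 : (s / 2) ^ 2 ≤ (s - 1) ^ 2 := by gcongr; linarith
  have h4 : s ^ 2 ≤ 8 / κ * r ^ 2 := by
    rw [div_mul_eq_mul_div, le_div_iff₀ hκ]
    nlinarith
  have h5 : 0 < 8 / κ := by positivity
  refine abs_le_of_sq_le_sq' ?_ (by positivity) |>.2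
  nlinarith [sq_nonneg r, mul_nonneg (sq_nonneg (8 / κ)) (sq_nonneg r),
    mul_nonneg h5.le (sq_nonneg r)]

/-- The position of a motion near the wall decays rapidly with its amplitude. -/
theorem rpow_position_le (h : WallBounds κ Λ a c η) (hr : r ∈ ampRange (wallForce a c η))
    (hr0 : r < 0) :
    position (wallForce a c η) r ^ (1 / 2 : ℝ) ≤ (64 * Λ) ^ 4 * |r| ^ (-8 : ℝ) := by
  have hΛ := h.Λ_pos
  have hs0 := position_pos hr
  have hs := h.isWell.position_lt_one hr hr0
  have h1 := h.isWell.two_mul_pot_position hr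
  have h2 := h.pot_le_of_le_one hs0 hs.le
  set s := position (wallForce a c η) r
  have hr' : 0 < |r| := abs_pos.2 hr0.ne
  have h3 : s ^ (1 / 8 : ℝ) * |r| ^ 2 ≤ 64 * Λ := by
    have e : s ^ (1 / 8 : ℝ) * s ^ (-1 / 8 : ℝ) = 1 := by
      rw [← Real.rpow_add hs0]
      norm_num
    rw [sq_abs]
    calc s ^ (1 / 8 : ℝ) * r ^ 2 ≤ s ^ (1 / 8 : ℝ) * (64 * Λ * s ^ (-1 / 8 : ℝ)) := by
          gcongr
          linarith
      _ = 64 * Λ * (s ^ (1 / 8 : ℝ) * s ^ (-1 / 8 : ℝ)) := by ring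
      _ = 64 * Λ := by rw [e, mul_one]
  have h4 : (s ^ (1 / 8 : ℝ) * |r| ^ 2) ^ 4 ≤ (64 * Λ) ^ 4 := by gcongr
  have h5 : (s ^ (1 / 8 : ℝ)) ^ 4 = s ^ (1 / 2 : ℝ) := by
    rw [← Real.rpow_mul_natCast hs0.le]
    norm_num
  have h6 : |r| ^ (-8 : ℝ) = (|r| ^ 8)⁻¹ := by
    rw [Real.rpow_neg hr'.le, show (8 : ℝ) = (8 : ℕ) by norm_num, Real.rpow_natCast]
  rw [mul_pow, h5, ← pow_mul] at h4
  rw [h6, ← div_eq_mul_inv, le_div_iff₀ (by positivity)]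
  exact h4

theorem abs_le_of_half_le_position (h : WallBounds κ Λ a c η)
    (hr : r ∈ ampRange (wallForce a c η)) (hr0 : r < 0)
    (hs : 1 / 2 ≤ position (wallForce a c η) r) : |r| ≤ 2 * Λ := by
  have hΛ := h.one_le
  have hs1 := h.isWell.position_lt_one hr hr0
  have h1 := h.isWell.two_mul_pot_position hr
  have h2 := h.pot_le_of_half_le hs hs1.le
  set s := position (wallForce a c η) r
  have h3 : (1 - s) ^ 2 ≤ (1 / 2) ^ 2 := by
    gcongr
    linarith
  refine abs_le_of_sq_le_sq ?_ (by positivity)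
  nlinarith

theorem exists_curvature_bound_right (κ Λ : ℝ) (hκ : 0 < κ) (hΛ : 1 ≤ Λ) :
    ∃ B > 0, ∀ a c η, WallBounds κ Λ a c η → ∀ r ∈ ampRange (wallForce a c η), 0 < r →
      |curvature (wallForce a c η) (wallForceDeriv a c η) r| ≤ B ∧
      |r| * |curvature (wallForce a c η) (wallForceDeriv a c η) r| ≤
        B * (|η| * |r| ^ (η - 1) + |r| ^ (-7 / 4 : ℝ)) := by
  have hΛ0 : 0 < Λ := by linarith
  set C₁ := 64 * Λ ^ 2 / κ ^ 3 with hC₁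
  set C₂ := 2 * Λ * (48 * Λ ^ 2) * (64 / κ ^ 3) with hC₂
  have hC₁0 : 0 < C₁ := by positivity
  have hC₂0 : 0 < C₂ := by positivity
  refine ⟨C₁ + C₁ * (2 * Λ) ^ 3 + C₂ * (2 * Λ) ^ 2, by positivity, fun a c η h r hr hr0 => ?_⟩
  have hs1 := h.isWell.one_lt_position hr hr0
  have hrs := h.le_mul_position_sub_one hr hr0
  rw [h.curvature_eq hr, abs_of_pos hr0]
  set s := position (wallForce a c η) r
  have hs0 : 0 < s := by linarith
  have hs1' : 0 < s - 1 := by linarith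
  have hF := h.force_ge hs1.le
  have hF0 : wallForce a c η s ≤ |wallForce a c η s| := le_abs_self _
  have hy1 : |wallNumerator a c η s / wallForce a c η s ^ 3| ≤ C₁ := by
    refine (abs_div_cube_le (h.abs_numerator_le_cube hs1.le) (by positivity)
      (hF.trans hF0)).trans_eq ?_
    rw [hC₁]
    field_simp
    norm_num
  have hpos1 : 0 ≤ C₁ * (2 * Λ) ^ 3 := by positivity
  have hpos2 : 0 ≤ C₂ * (2 * Λ) ^ 2 := by positivity
  have hη0 : 0 ≤ |η| * r ^ (η - 1) := by positivity
  have hr7 : 0 < r ^ (-7 / 4 : ℝ) := by positivity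
  refine ⟨by linarith, ?_⟩
  rcases lt_or_ge s 2 with hs2 | hs2
  · have hR : r ≤ 2 * Λ := hrs.trans (mul_le_of_le_one_right (by positivity) (by linarith))
    have := le_cube_mul_rpow hr0 (by linarith) hR
    calc r * |wallNumerator a c η s / wallForce a c η s ^ 3|
        ≤ (2 * Λ) ^ 3 * r ^ (-7 / 4 : ℝ) * C₁ := by gcongr
      _ = C₁ * (2 * Λ) ^ 3 * (0 + r ^ (-7 / 4 : ℝ)) := by ring
      _ ≤ _ := by
        refine mul_le_mul (by linarith) (by linarith) (by positivity) (by positivity)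
  · have hg : κ * s / 4 ≤ |wallForce a c η s| := by
      refine le_trans ?_ (hF.trans hF0)
      nlinarith
    have hrs' : r ≤ 2 * Λ * s := hrs.trans (by gcongr; linarith)
    have h1 := abs_div_cube_le (h.abs_numerator_le_rpow hs1.le) (by positivity) hg
    have e1 : s * s ^ (1 + η) / s ^ 3 = s ^ (η - 1) := by
      rw [Real.rpow_add hs0, Real.rpow_one, Real.rpow_sub_one hs0.ne']
      field_simp
    have e2 : s * s ^ (1 / 4 : ℝ) / s ^ 3 = s ^ (-7 / 4 : ℝ) := by
      rw [div_eq_iff (by positivity), ← Real.rpow_one_add' hs0.le (by norm_num),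
        ← Real.rpow_natCast s 3, ← Real.rpow_add hs0]
      norm_num
    have h2 : s ^ (η - 1) ≤ (2 * Λ) ^ 2 * r ^ (η - 1) :=
      rpow_le_sq_mul_rpow hr0 (by linarith) hrs' (by linarith [h.le_eta]) (by linarith [h.eta_le])
    have h3 : s ^ (-7 / 4 : ℝ) ≤ (2 * Λ) ^ 2 * r ^ (-7 / 4 : ℝ) :=
      rpow_le_sq_mul_rpow hr0 (by linarith) hrs' (by norm_num) (by norm_num)
    calc r * |wallNumerator a c η s / wallForce a c η s ^ 3|
        ≤ 2 * Λ * s * (48 * Λ ^ 2 * (|η| * s ^ (1 + η) + s ^ (1 / 4 : ℝ)) / (κ * s / 4) ^ 3) := by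
          gcongr
      _ = C₂ * (|η| * (s * s ^ (1 + η) / s ^ 3) + s * s ^ (1 / 4 : ℝ) / s ^ 3) := by
          rw [hC₂]
          field_simp
          norm_num
      _ ≤ C₂ * (|η| * ((2 * Λ) ^ 2 * r ^ (η - 1)) + (2 * Λ) ^ 2 * r ^ (-7 / 4 : ℝ)) := by
          rw [e1, e2]
          gcongr
      _ = C₂ * (2 * Λ) ^ 2 * (|η| * r ^ (η - 1) + r ^ (-7 / 4 : ℝ)) := by ring
      _ ≤ _ := by
          gcongr
          linarith

theorem abs_curvature_le_of_position_le_half (h : WallBounds κ Λ a c η) (hs0 : 0 < s)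
    (hs : s ≤ 1 / 2) : |wallNumerator a c η s / wallForce a c η s ^ 3| ≤
      (4 / κ + 192 * Λ ^ 2 * (64 / κ ^ 3)) * s ^ (1 / 2 : ℝ) := by
  have hκ := h.pos
  have hΛ := h.Λ_pos
  have hs1 : s ≤ 1 := by linarith
  have hW := h.pot_le_of_le_one hs0 hs1
  have hW0 := h.isWell.pot_nonneg hs0
  have hD := h.abs_deriv_le hs0 hs1
  have hG : κ / 4 * s ^ (2 * η - 1) ≤ |wallForce a c η s| := by
    refine le_trans ?_ ((h.neg_force_ge hs0 hs1).trans (neg_le_abs _))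
    refine mul_le_mul_of_nonneg_right ?_ (by positivity)
    nlinarith
  set G := κ / 4 * s ^ (2 * η - 1) with hGdef
  have hG0 : 0 < G := by positivity
  have hF0 : 0 < |wallForce a c η s| := hG0.trans_le hG
  have e1 : (s ^ (2 * η - 1))⁻¹ = s ^ (1 - 2 * η) := by
    rw [← Real.rpow_neg hs0.le]
    congr 1
    ring
  have e2 : s ^ (-1 / 8 : ℝ) * s ^ (2 * η - 2) * (s ^ (1 - 2 * η)) ^ 3 =
      s ^ (7 / 8 - 4 * η) := by
    rw [← Real.rpow_mul_natCast hs0.le, ← Real.rpow_add hs0, ← Real.rpow_add hs0]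
    congr 1
    push_cast
    ring
  have h1 : s ^ (1 - 2 * η) ≤ s ^ (1 / 2 : ℝ) :=
    Real.rpow_le_rpow_of_exponent_ge hs0 hs1 (by linarith [h.eta_le])
  have h2 : s ^ (7 / 8 - 4 * η) ≤ s ^ (1 / 2 : ℝ) :=
    Real.rpow_le_rpow_of_exponent_ge hs0 hs1 (by linarith [h.eta_le])
  have hN : |wallNumerator a c η s / wallForce a c η s ^ 3| ≤
      |wallForce a c η s|⁻¹ + 2 * pot (wallForce a c η) s * |wallForceDeriv a c η s| /
        |wallForce a c η s| ^ 3 := by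
    rw [abs_div, abs_pow, wallNumerator, div_le_iff₀ (by positivity), add_mul,
      div_mul_cancel₀ _ (by positivity)]
    refine (abs_sub _ _).trans ?_
    rw [abs_mul, abs_mul, abs_two, abs_of_nonneg hW0, abs_pow]
    refine add_le_add_left (le_of_eq ?_) _
    field_simp
  calc _ ≤ _ := hN
    _ ≤ G⁻¹ + 2 * (32 * Λ * s ^ (-1 / 8 : ℝ)) * (3 * Λ * s ^ (2 * η - 2)) / G ^ 3 := by gcongr
    _ = 4 / κ * s ^ (1 - 2 * η) + 192 * Λ ^ 2 * (64 / κ ^ 3) *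
          (s ^ (-1 / 8 : ℝ) * s ^ (2 * η - 2) * (s ^ (1 - 2 * η)) ^ 3) := by
        rw [← e1, hGdef]
        field_simp
        ring
    _ ≤ 4 / κ * s ^ (1 / 2 : ℝ) + 192 * Λ ^ 2 * (64 / κ ^ 3) * s ^ (1 / 2 : ℝ) := by
        rw [e2]
        gcongr
    _ = _ := by ring

theorem exists_curvature_bound_left (κ Λ : ℝ) (hκ : 0 < κ) (hΛ : 1 ≤ Λ) :
    ∃ B > 0, ∀ a c η, WallBounds κ Λ a c η → ∀ r ∈ ampRange (wallForce a c η), r < 0 →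
      |curvature (wallForce a c η) (wallForceDeriv a c η) r| ≤ B ∧
      |r| * |curvature (wallForce a c η) (wallForceDeriv a c η) r| ≤
        B * (|η| * |r| ^ (η - 1) + |r| ^ (-7 / 4 : ℝ)) := by
  have hΛ0 : 0 < Λ := by linarith
  set C₁ := 4096 * Λ ^ 2 / κ ^ 3 with hC₁
  set C₂ := 4 / κ + 192 * Λ ^ 2 * (64 / κ ^ 3) with hC₂
  have hC₁0 : 0 < C₁ := by positivity
  have hC₂0 : 0 < C₂ := by positivity
  refine ⟨C₁ + C₁ * (2 * Λ) ^ 3 + C₂ + C₂ * (64 * Λ) ^ 4, by positivity,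
    fun a c η h r hr hr0 => ?_⟩
  have hs1 := h.isWell.position_lt_one hr hr0
  have hs0 := position_pos hr
  have hhalf := h.abs_le_of_half_le_position hr hr0
  have hdec := h.rpow_position_le hr hr0
  rw [h.curvature_eq hr]
  set s := position (wallForce a c η) r
  have hr' : 0 < |r| := abs_pos.2 hr0.ne
  have hη0 : 0 ≤ |η| * |r| ^ (η - 1) := by positivity
  have hr7 : 0 < |r| ^ (-7 / 4 : ℝ) := by positivity
  have hpos1 : 0 < C₁ * (2 * Λ) ^ 3 := by positivity
  have hpos2 : 0 < C₂ * (64 * Λ) ^ 4 := by positivity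
  set y := |wallNumerator a c η s / wallForce a c η s ^ 3|
  have hfin : ∀ K, 0 < K → K ≤ C₁ + C₁ * (2 * Λ) ^ 3 + C₂ + C₂ * (64 * Λ) ^ 4 →
      |r| * y ≤ K * |r| ^ (-7 / 4 : ℝ) →
      |r| * y ≤ (C₁ + C₁ * (2 * Λ) ^ 3 + C₂ + C₂ * (64 * Λ) ^ 4) *
        (|η| * |r| ^ (η - 1) + |r| ^ (-7 / 4 : ℝ)) := fun K hK hKle hle =>
    hle.trans (mul_le_mul hKle (by linarith) hr7.le (by linarith))
  rcases le_or_gt (1 / 2) s with hs2 | hs2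
  · have hs1' : 0 < 1 - s := by linarith
    have hF : κ * (1 - s) / 2 ≤ |wallForce a c η s| := by
      refine le_trans ?_ ((h.neg_force_ge hs0 hs1.le).trans (neg_le_abs _))
      have : 1 ≤ s ^ (2 * η - 1) :=
        Real.one_le_rpow_of_pos_of_le_one_of_nonpos hs0 hs1.le (by linarith [h.eta_le])
      calc κ * (1 - s) / 2 = κ / 2 * (1 - s) * 1 := by ring
        _ ≤ _ := by gcongr
    have hy : y ≤ C₁ := by
      refine (abs_div_cube_le (h.abs_numerator_le_cube_of_le_one hs2 hs1.le) (by positivity)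
        hF).trans_eq ?_
      rw [hC₁]
      field_simp
      norm_num
    refine ⟨by linarith, hfin (C₁ * (2 * Λ) ^ 3) hpos1 (by linarith) ?_⟩
    have := le_cube_mul_rpow hr' (by linarith) (hhalf hs2)
    calc |r| * y ≤ (2 * Λ) ^ 3 * |r| ^ (-7 / 4 : ℝ) * C₁ := by gcongr
      _ = _ := by ring
  · have hy : y ≤ C₂ * s ^ (1 / 2 : ℝ) := h.abs_curvature_le_of_position_le_half hs0 hs2.le
    have hs' : s ^ (1 / 2 : ℝ) ≤ 1 := Real.rpow_le_one hs0.le hs1.le (by norm_num)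
    have hy' : y ≤ C₂ := hy.trans (mul_le_of_le_one_right hC₂0.le hs')
    refine ⟨by linarith, ?_⟩
    rcases le_or_gt |r| 1 with h1 | h1
    · refine hfin C₂ hC₂0 (by linarith) ?_
      have := le_cube_mul_rpow hr' le_rfl h1
      rw [one_pow, one_mul] at this
      calc |r| * y ≤ |r| ^ (-7 / 4 : ℝ) * C₂ := by gcongr
        _ = _ := by ring
    · refine hfin (C₂ * (64 * Λ) ^ 4) hpos2 (by linarith) ?_
      have e : |r| * |r| ^ (-8 : ℝ) ≤ |r| ^ (-7 / 4 : ℝ) := by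
        rw [← Real.rpow_one_add' hr'.le (by norm_num)]
        exact Real.rpow_le_rpow_of_exponent_le h1.le (by norm_num)
      calc |r| * y ≤ |r| * (C₂ * ((64 * Λ) ^ 4 * |r| ^ (-8 : ℝ))) := by
            gcongr
            exact hy.trans (by gcongr)
        _ = C₂ * (64 * Λ) ^ 4 * (|r| * |r| ^ (-8 : ℝ)) := by ring
        _ ≤ _ := by gcongr

theorem exists_curvature_bound (κ Λ : ℝ) (hκ : 0 < κ) (hΛ : 1 ≤ Λ) :
    ∃ B > 0, ∀ a c η, WallBounds κ Λ a c η → ∀ r ∈ ampRange (wallForce a c η), r ≠ 0 →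
      |curvature (wallForce a c η) (wallForceDeriv a c η) r| ≤ B ∧
      |r| * |curvature (wallForce a c η) (wallForceDeriv a c η) r| ≤
        B * (|η| * |r| ^ (η - 1) + |r| ^ (-7 / 4 : ℝ)) := by
  obtain ⟨B₁, hB₁, h₁⟩ := exists_curvature_bound_left κ Λ hκ hΛ
  obtain ⟨B₂, hB₂, h₂⟩ := exists_curvature_bound_right κ Λ hκ hΛ
  refine ⟨B₁ + B₂, by positivity, fun a c η h r hr hr0 => ?_⟩
  have hr' : 0 < |r| := abs_pos.2 hr0
  have hnn : 0 ≤ |η| * |r| ^ (η - 1) + |r| ^ (-7 / 4 : ℝ) := by positivity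
  rcases lt_or_gt_of_ne hr0 with hlt | hgt
  · obtain ⟨h3, h4⟩ := h₁ a c η h r hr hlt
    exact ⟨by linarith, h4.trans (by gcongr; linarith)⟩
  · obtain ⟨h3, h4⟩ := h₂ a c η h r hr hgt
    exact ⟨by linarith, h4.trans (by gcongr; linarith)⟩

/-! ### Large periodic motions are not critical -/

theorem abs_boundary_left_le (h : WallBounds κ Λ a c η) (hρ : -ρ ∈ ampRange (wallForce a c η))
    (hρ1 : 1 ≤ ρ) (hs : position (wallForce a c η) (-ρ) ≤ 1 / 2) :
    |ρ * slope (wallForce a c η) (wallForceDeriv a c η) (-ρ) + position (wallForce a c η) (-ρ)| ≤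
      (256 * Λ / κ + 1) * (64 * Λ) ^ 4 * ρ ^ (-3 / 4 : ℝ) := by
  have hκ := h.pos
  have hΛ := h.Λ_pos
  have hρ0 : 0 < ρ := by linarith
  have hneg : -ρ < 0 := by linarith
  have hs0 := position_pos hρ
  have hdec := h.rpow_position_le hρ hneg
  have hsl := h.isWell.slope_pos hρ
  have hpot := h.isWell.two_mul_pot_position hρ
  rw [slope_of_ne hneg.ne] at hsl ⊢
  set s := position (wallForce a c η) (-ρ)
  have hs1 : s ≤ 1 := by linarith
  have hW := h.pot_le_of_le_one hs0 hs1
  have hG : κ / 4 * s ^ (2 * η - 1) ≤ -wallForce a c η s := by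
    refine le_trans ?_ (h.neg_force_ge hs0 hs1)
    refine mul_le_mul_of_nonneg_right ?_ (by positivity)
    nlinarith
  have hG0 : 0 < κ / 4 * s ^ (2 * η - 1) := by positivity
  rw [abs_neg, abs_of_pos hρ0] at hdec
  rw [abs_of_pos (by positivity)]
  have e : s ^ (-1 / 8 : ℝ) / s ^ (2 * η - 1) ≤ s ^ (1 / 2 : ℝ) := by
    rw [← Real.rpow_sub hs0]
    exact Real.rpow_le_rpow_of_exponent_ge hs0 hs1 (by linarith [h.eta_le])
  have e2 : s ≤ s ^ (1 / 2 : ℝ) := by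
    conv_lhs => rw [← Real.rpow_one s]
    exact Real.rpow_le_rpow_of_exponent_ge hs0 hs1 (by norm_num)
  calc ρ * (-ρ / wallForce a c η s) + s = ρ ^ 2 / (-wallForce a c η s) + s := by
        rw [div_neg, neg_div]
        ring
    _ ≤ 64 * Λ * s ^ (-1 / 8 : ℝ) / (κ / 4 * s ^ (2 * η - 1)) + s ^ (1 / 2 : ℝ) := by
        gcongr
        nlinarith
    _ = 256 * Λ / κ * (s ^ (-1 / 8 : ℝ) / s ^ (2 * η - 1)) + s ^ (1 / 2 : ℝ) := by
        field_simp
        ring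
    _ ≤ 256 * Λ / κ * s ^ (1 / 2 : ℝ) + s ^ (1 / 2 : ℝ) := by gcongr
    _ = (256 * Λ / κ + 1) * s ^ (1 / 2 : ℝ) := by ring
    _ ≤ (256 * Λ / κ + 1) * ((64 * Λ) ^ 4 * ρ ^ (-3 / 4 : ℝ)) := by
        gcongr
        refine hdec.trans ?_
        gcongr
        norm_num
    _ = _ := by ring

/-- The virial `2 W - s f` is a pure power of `s` up to lower order. The coefficient of that power
is the one place where `a ≠ c` is used. -/
theorem le_abs_virial (h : WallBounds κ Λ a c η) (hac : κ ≤ |a - c|) (hs : 1 ≤ s) :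
    κ / 2 * s ^ (1 + η) - 17 * Λ * s ^ (1 / 4 : ℝ) ≤
      |2 * pot (wallForce a c η) s - s * wallForce a c η s| := by
  have hκ := h.pos
  have hΛ := h.Λ_pos
  have hη1 : 0 < 1 + η := by linarith [h.le_eta]
  have hη2 : 0 < 1 - η := by linarith [h.eta_le]
  set q := (1 - η) / (1 + η) with hq
  have hq1 : 3 / 4 ≤ q := by
    rw [hq, le_div_iff₀ hη1]
    linarith [h.eta_le]
  have hq2 : q ≤ 2 := by
    rw [hq, div_le_iff₀ hη1]
    linarith [h.le_eta]
  have key := abs_sub_le_sub_of_abs_deriv_le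
    (u := fun t => 2 * pot (wallForce a c η) t - t * wallForce a c η t +
      (a - c) * (q * t ^ (1 + η)))
    (u' := fun t => -(2 * c * (1 - η) * t ^ (2 * η - 1)))
    (v := fun t => 12 * Λ * t ^ (1 / 4 : ℝ)) (v' := fun t => 3 * Λ * t ^ (-3 / 4 : ℝ)) hs
    (fun t ht => by
      have ht0 : 0 < t := one_pos.trans_le ht.1
      refine ((((h.isWell.hasDerivAt_pot ht0).const_mul 2).sub
        ((hasDerivAt_id t).mul (hasDerivAt_wallForce ht0))).add
        (((hasDerivAt_rpow_of_pos ht0 (1 + η)).const_mul q).const_mul (a - c))).congr_deriv ?_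
      have e1 : t ^ (2 * η - 1) = t * t ^ (2 * η - 2) := by
        rw [← Real.rpow_one_add' ht0.le (by linarith [h.eta_le])]
        congr 1
        ring
      have e2 : t ^ η = t * t ^ (η - 1) := by
        rw [Real.rpow_sub_one ht0.ne', mul_div_cancel₀ _ ht0.ne']
      have e3 : q * (1 + η) = 1 - η := div_mul_cancel₀ _ hη1.ne'
      simp only [id, wallForce, wallForceDeriv]
      rw [add_sub_cancel_left, ← mul_assoc q, e3, e1, e2]
      ring)
    (fun t ht => by
      refine ((hasDerivAt_rpow_of_pos (one_pos.trans_le ht.1) (1 / 4)).const_mul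
        (12 * Λ)).congr_deriv ?_
      rw [show (1 / 4 : ℝ) - 1 = -3 / 4 by norm_num]
      ring)
    (fun t ht => by
      have ht0 : 0 < t := one_pos.trans_le ht.1
      have hc := h.c_pos
      have e1 : t ^ (2 * η - 1) ≤ t ^ (-3 / 4 : ℝ) :=
        Real.rpow_le_rpow_of_exponent_le ht.1 (by linarith [h.eta_le])
      have e2 : 2 * c * (1 - η) ≤ 3 * Λ := by nlinarith [h.c_le, h.le_eta]
      rw [abs_neg, abs_of_nonneg (by positivity)]
      gcongr)
  simp only [pot_one, h.isWell.map_one, Real.one_rpow, mul_zero, sub_zero, mul_one,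
    zero_add] at key
  have hs4 : 1 ≤ s ^ (1 / 4 : ℝ) := Real.one_le_rpow hs (by norm_num)
  have hp : 0 < s ^ (1 + η) := by positivity
  set Q := 2 * pot (wallForce a c η) s - s * wallForce a c η s
  have h1 : |(a - c) * (q * s ^ (1 + η))| ≤ |Q| + 12 * Λ * s ^ (1 / 4 : ℝ) + 2 * Λ := by
    have e : (a - c) * (q * s ^ (1 + η)) =
        (Q + (a - c) * (q * s ^ (1 + η)) - (a - c) * q) - Q + (a - c) * q := by ring
    have e2 : |(a - c) * q| ≤ Λ * 2 := by
      rw [abs_mul, abs_of_pos (by linarith : 0 < q)]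
      exact mul_le_mul h.abs_sub_le hq2 (by linarith) hΛ.le
    rw [e]
    refine (abs_add_le _ _).trans ?_
    have := abs_sub (Q + (a - c) * (q * s ^ (1 + η)) - (a - c) * q) Q
    linarith
  rw [abs_mul, abs_mul, abs_of_pos (by linarith : 0 < q), abs_of_pos hp] at h1
  have h2 : κ * (3 / 4 * s ^ (1 + η)) ≤ |a - c| * (q * s ^ (1 + η)) := by gcongr
  have h3 : 0 < κ * s ^ (1 + η) := by positivity
  nlinarith

theorem le_abs_boundary_right (h : WallBounds κ Λ a c η) (hac : κ ≤ |a - c|)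
    (hρ : ρ ∈ ampRange (wallForce a c η)) (hρ0 : 0 < ρ)
    (hs : 2 ≤ position (wallForce a c η) ρ) :
    κ / (8 * Λ) * position (wallForce a c η) ρ ^ η -
        68 * Λ / κ * position (wallForce a c η) ρ ^ (-3 / 4 : ℝ) ≤
      |ρ * slope (wallForce a c η) (wallForceDeriv a c η) ρ - position (wallForce a c η) ρ| := by
  have hκ := h.pos
  have hΛ := h.Λ_pos
  have hpot := h.isWell.two_mul_pot_position hρ
  rw [slope_of_ne hρ0.ne']
  set s := position (wallForce a c η) ρ
  have hs1 : 1 ≤ s := by linarith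
  have hs0 : 0 < s := by linarith
  have hF1 : κ * s / 4 ≤ wallForce a c η s := le_trans (by nlinarith) (h.force_ge hs1)
  have hF2 : wallForce a c η s ≤ 4 * Λ * s := (h.force_le hs1).trans (by gcongr; linarith)
  have hF0 : 0 < wallForce a c η s := lt_of_lt_of_le (by positivity) hF1
  have hQ := h.le_abs_virial hac hs1
  have e : ρ * (ρ / wallForce a c η s) - s =
      (2 * pot (wallForce a c η) s - s * wallForce a c η s) / wallForce a c η s := by
    rw [hpot]
    field_simp
  have e1 : s ^ (1 + η) = s * s ^ η := by rw [Real.rpow_add hs0, Real.rpow_one]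
  have e2 : s ^ (1 / 4 : ℝ) = s * s ^ (-3 / 4 : ℝ) := by
    rw [← Real.rpow_one_add' hs0.le (by norm_num)]
    norm_num
  rw [e, abs_div, abs_of_pos hF0, le_div_iff₀ hF0]
  refine le_trans ?_ hQ
  have h1 : κ / (8 * Λ) * s ^ η * wallForce a c η s ≤ κ / 2 * s ^ (1 + η) := by
    calc κ / (8 * Λ) * s ^ η * wallForce a c η s ≤ κ / (8 * Λ) * s ^ η * (4 * Λ * s) := by gcongr
      _ = κ / 2 * s ^ (1 + η) := by
        rw [e1]
        field_simp
        norm_num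
  have h2 : 17 * Λ * s ^ (1 / 4 : ℝ) ≤
      68 * Λ / κ * s ^ (-3 / 4 : ℝ) * wallForce a c η s := by
    calc 17 * Λ * s ^ (1 / 4 : ℝ) = 68 * Λ / κ * s ^ (-3 / 4 : ℝ) * (κ * s / 4) := by
          rw [e2]
          field_simp
          norm_num
      _ ≤ _ := by gcongr
  linarith

/-- Motions that reach far out are not critical, uniformly for small `η` and for `a`, `c` and
`a - c` bounded away from zero. -/
theorem exists_forall_deriv_period_ne_zero (κ Λ : ℝ) (hκ : 0 < κ) (hΛ : 1 ≤ Λ) :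
    ∃ η₀ > 0, ∃ M₀ : ℝ, ∀ a c η, WallBounds κ Λ a c η → |η| ≤ η₀ → κ ≤ |a - c| →
      ∀ ρ ∈ ampRange (wallForce a c η), -ρ ∈ ampRange (wallForce a c η) → 0 < ρ →
      M₀ < position (wallForce a c η) ρ →
      ∃ T' ≠ 0, HasDerivAt (period (wallForce a c η) (wallForceDeriv a c η)) T' ρ := by
  obtain ⟨B, hB, hcurv⟩ := exists_curvature_bound κ Λ hκ hΛ
  have hΛ0 : 0 < Λ := by linarith
  have hπ := Real.pi_pos
  set L := 1 + 8 / κ with hL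
  have hL1 : 1 ≤ L := by
    have : 0 < 8 / κ := by positivity
    linarith
  set C := 2 * Λ + L ^ 2 with hC
  have hC0 : 0 < C := by positivity
  set C' := (256 * Λ / κ + 1) * (64 * Λ) ^ 4 with hC'
  have hC'0 : 0 < C' := by positivity
  set K := 68 * Λ / κ + (C' + Real.pi * B) * L ^ 2 with hK
  have hK0 : 0 < K := by positivity
  set β := κ / (8 * Λ) with hβ
  have hβ0 : 0 < β := by positivity
  refine ⟨β / 2 / (Real.pi * B * C), by positivity, 2 + 2 * Λ * L + (2 * K / β) ^ 2, ?_⟩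
  intro a c η h hη hac ρ hρ hρ' hρ0 hM
  have hΛL : 0 < Λ * L := by positivity
  have hsq := sq_nonneg (2 * K / β)
  have hM2 : 2 ≤ position (wallForce a c η) ρ := by linarith
  have hMρ := h.position_le_mul hρ hρ0 hM2
  have hρM := h.le_mul_position_sub_one hρ hρ0
  have hbr := h.le_abs_boundary_right hac hρ hρ0 hM2
  obtain ⟨T', hT', hbound⟩ := h.isWell.exists_hasDerivAt_period hB.le (abs_nonneg η)
    (by linarith [h.le_eta]) (fun r hr hr0 => (hcurv a c η h r hr hr0).1)
    (fun r hr hr0 => (hcurv a c η h r hr hr0).2) hρ hρ' hρ0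
  refine ⟨T', ?_, hT'⟩
  rintro rfl
  set M := position (wallForce a c η) ρ
  have hM0 : 0 < M := by linarith
  have hρΛ : 2 * Λ < ρ := by
    have : L * (2 * Λ) < L * ρ := by linarith
    exact lt_of_mul_lt_mul_left this (by linarith)
  have hm : position (wallForce a c η) (-ρ) ≤ 1 / 2 := by
    by_contra hm
    have := h.abs_le_of_half_le_position hρ' (by linarith) (not_le.1 hm).le
    rw [abs_neg, abs_of_pos hρ0] at this
    linarith
  have hbl := h.abs_boundary_left_le hρ' (by linarith) hm
  have h1 : ρ ^ (-3 / 4 : ℝ) ≤ L ^ 2 * M ^ (-3 / 4 : ℝ) :=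
    rpow_le_sq_mul_rpow hM0 hL1 hMρ (by norm_num) (by norm_num)
  have h2 : ρ ^ η ≤ C * M ^ η := by
    have hMη : 0 < M ^ η := by positivity
    rcases le_total 0 η with h0 | h0
    · have e1 : ρ ^ η ≤ (2 * Λ * M) ^ η :=
        Real.rpow_le_rpow hρ0.le (hρM.trans (by gcongr; linarith)) h0
      rw [Real.mul_rpow (by positivity) hM0.le] at e1
      have e2 : (2 * Λ) ^ η ≤ 2 * Λ := by
        conv_rhs => rw [← Real.rpow_one (2 * Λ)]
        exact Real.rpow_le_rpow_of_exponent_le (by linarith) (by linarith [h.eta_le])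
      refine e1.trans ?_
      gcongr
      refine e2.trans ?_
      linarith [sq_nonneg L]
    · refine (rpow_le_sq_mul_rpow hM0 hL1 hMρ (by linarith [h.le_eta]) h0).trans ?_
      gcongr
      linarith
  have h3 : Real.pi * B * (|η| * ρ ^ η) ≤ β / 2 * M ^ η := by
    rw [le_div_iff₀ (by positivity)] at hη
    calc Real.pi * B * (|η| * ρ ^ η) ≤ Real.pi * B * (|η| * (C * M ^ η)) := by gcongr
      _ = |η| * (Real.pi * B * C) * M ^ η := by ring
      _ ≤ _ := by gcongr
  -- the main term `β * M ^ η` beats the error, which is of order `M ^ (-3 / 4)`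
  have h4 : K * M ^ (-3 / 4 : ℝ) < β / 2 * M ^ η := by
    have e1 : 2 * K / β < M ^ (1 / 2 : ℝ) := by
      rw [← Real.sqrt_eq_rpow]
      exact Real.lt_sqrt_of_sq_lt (by linarith)
    have e2 : M ^ (1 / 2 : ℝ) * M ^ (-3 / 4 : ℝ) ≤ M ^ η := by
      rw [← Real.rpow_add hM0]
      exact Real.rpow_le_rpow_of_exponent_le (by linarith) (by linarith [h.le_eta])
    have e3 : 0 < M ^ (-3 / 4 : ℝ) := by positivity
    rw [div_lt_iff₀ hβ0] at e1
    nlinarith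
  rw [mul_zero, zero_div, zero_sub, abs_neg] at hbound
  have h5 : ∀ X Y : ℝ, |X| ≤ |X + Y| + |Y| := fun X Y => by
    have := abs_sub (X + Y) Y
    rwa [add_sub_cancel_right] at this
  have h6 := (hbr.trans (h5 _ _)).trans (add_le_add hbound hbl)
  have h7 : (C' + Real.pi * B) * ρ ^ (-3 / 4 : ℝ) ≤
      (C' + Real.pi * B) * (L ^ 2 * M ^ (-3 / 4 : ℝ)) := by gcongr
  rw [hK] at h4
  linarith

end WallBounds

namespace PlanarCenter

open IsWell

/-! ### Uniqueness of solutions -/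

theorem IsSolution.unique {X : ℝ × ℝ → ℝ × ℝ} (hX : ContDiff ℝ 1 X) {γ δ : ℝ → ℝ × ℝ}
    (hγ : IsSolution X γ) (hδ : IsSolution X δ) (h0 : γ 0 = δ 0) : γ = δ := by
  funext t
  have hcγ : Continuous γ := continuous_iff_continuousAt.2 fun t => (hγ t).continuousAt
  have hcδ : Continuous δ := continuous_iff_continuousAt.2 fun t => (hδ t).continuousAt
  have hK : IsCompact (γ '' Icc (-(|t| + 1)) (|t| + 1) ∪ δ '' Icc (-(|t| + 1)) (|t| + 1)) :=
    (isCompact_Icc.image hcγ).union (isCompact_Icc.image hcδ)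
  obtain ⟨R, hR⟩ := hK.isBounded.subset_closedBall 0
  obtain ⟨K, hLip⟩ := hX.contDiffOn.exists_lipschitzOnWith one_ne_zero
    (convex_closedBall (0 : ℝ × ℝ) R) (isCompact_closedBall 0 R)
  have h1 := abs_nonneg t
  refine ODE_solution_unique_of_mem_Ioo (v := fun _ => X) (s := fun _ => Metric.closedBall 0 R)
    (t₀ := 0) (a := -(|t| + 1)) (b := |t| + 1) (fun _ _ => hLip) ⟨by linarith, by linarith⟩
    (fun s hs => ⟨hγ s, hR (Or.inl ⟨s, Ioo_subset_Icc_self hs, rfl⟩)⟩)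
    (fun s hs => ⟨hδ s, hR (Or.inr ⟨s, Ioo_subset_Icc_self hs, rfl⟩)⟩) h0
    ⟨by linarith [neg_abs_le t], by linarith [le_abs_self t]⟩

theorem contDiff_loud (a : ℝ × ℝ) : ContDiff ℝ 1 (loud a) := by
  unfold loud
  fun_prop

/-! ### Reduction of the Loud systems to potential wells -/

/-- The force of the potential well to which the Loud system with parameter `(D, F)` reduces. -/
noncomputable def loudForce (D F : ℝ) : ℝ → ℝ := wallForce (F * (1 + D)) (-(F * D)) (1 - F⁻¹)

/-- The derivative of `loudForce D F`. -/
noncomputable def loudForceDeriv (D F : ℝ) : ℝ → ℝ :=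
  wallForceDeriv (F * (1 + D)) (-(F * D)) (1 - F⁻¹)

/-- The position of the phase point `q` in the well. The invariant line `u = 1` is sent to
infinity. -/
noncomputable def wellPos (F : ℝ) (q : ℝ × ℝ) : ℝ := (1 - q.1) ^ (-F)

/-- The velocity of the phase point `q` in the well. -/
noncomputable def wellVel (F : ℝ) (q : ℝ × ℝ) : ℝ := -(F * wellPos F q * q.2)

/-- The phase point with position `s` and velocity `p` in the well. -/
noncomputable def ofWell (F s p : ℝ) : ℝ × ℝ := (1 - s ^ (-F⁻¹), -(p / (F * s)))

/-- The energy in the well, a first integral of the Loud system in the half plane `u < 1`. -/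
noncomputable def energy (D F : ℝ) (q : ℝ × ℝ) : ℝ :=
  wellVel F q ^ 2 / 2 + pot (loudForce D F) (wellPos F q)

/-- The points of the half plane `u < 1` whose energy is positive and less than the height of each
of the two walls of the well. -/
def wellRegion (D F : ℝ) : Set (ℝ × ℝ) :=
  {q | q.1 < 1 ∧ 0 < energy D F q ∧ √(2 * energy D F q) ∈ ampRange (loudForce D F) ∧
    -√(2 * energy D F q) ∈ ampRange (loudForce D F)}

variable {D F s p : ℝ} {q : ℝ × ℝ}

theorem wellPos_pos (hq : q.1 < 1) : 0 < wellPos F q :=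
  Real.rpow_pos_of_pos (by linarith) _

theorem wellPos_rpow (hF : 0 < F) (hq : q.1 < 1) : wellPos F q ^ (-F⁻¹) = 1 - q.1 := by
  rw [wellPos, ← Real.rpow_mul (by linarith), neg_mul_neg, mul_inv_cancel₀ hF.ne', Real.rpow_one]

theorem ofWell_wellPos (hF : 0 < F) (hq : q.1 < 1) :
    ofWell F (wellPos F q) (wellVel F q) = q := by
  have := (wellPos_pos (F := F) hq).ne'
  rw [ofWell, wellPos_rpow hF hq, wellVel]
  ext
  · simp
  · field_simp

theorem ofWell_fst_lt (hs : 0 < s) : (ofWell F s p).1 < 1 := by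
  have : 0 < s ^ (-F⁻¹) := by positivity
  simp only [ofWell]
  linarith

theorem wellPos_ofWell (hF : 0 < F) (hs : 0 < s) : wellPos F (ofWell F s p) = s := by
  rw [wellPos, ofWell, sub_sub_cancel, ← Real.rpow_mul hs.le, neg_mul_neg,
    inv_mul_cancel₀ hF.ne', Real.rpow_one]

theorem wellVel_ofWell (hF : 0 < F) (hs : 0 < s) : wellVel F (ofWell F s p) = p := by
  rw [wellVel, wellPos_ofWell hF hs, ofWell]
  field_simp

theorem loudForce_eq (hs : 0 < s) : loudForce D F s =
    F * s * ((1 - s ^ (-F⁻¹)) + D * (1 - s ^ (-F⁻¹)) ^ 2) := by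
  have h1 : s ^ (1 - F⁻¹) = s * s ^ (-F⁻¹) := by
    rw [sub_eq_add_neg, Real.rpow_add hs, Real.rpow_one]
  rw [loudForce, wallForce_eq hs, h1, show 1 - F⁻¹ - 1 = -F⁻¹ by ring]
  ring

/-- The derivative of the energy along a curve is a multiple of the determinant of the vector field
and the velocity of the curve. -/
theorem hasDerivAt_energy (hF : 0 < F) (hw : IsWell (loudForce D F) (loudForceDeriv D F))
    {σ : ℝ → ℝ × ℝ} {σ' : ℝ × ℝ} {t : ℝ} (hσ : HasDerivAt σ σ' t) (ht : (σ t).1 < 1) :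
    HasDerivAt (fun τ => energy D F (σ τ))
      (F ^ 2 * wellPos F (σ t) ^ 2 / (1 - (σ t).1) *
        ((loud (D, F) (σ t)).2 * σ'.1 - (loud (D, F) (σ t)).1 * σ'.2)) t := by
  have h1 : HasDerivAt (fun τ => (σ τ).1) σ'.1 t := (ContinuousLinearMap.fst ℝ ℝ ℝ).hasFDerivAt.comp_hasDerivAt t hσ
  have h2 : HasDerivAt (fun τ => (σ τ).2) σ'.2 t := (ContinuousLinearMap.snd ℝ ℝ ℝ).hasFDerivAt.comp_hasDerivAt t hσ
  have hx : 0 < 1 - (σ t).1 := by linarith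
  have hs := wellPos_pos (F := F) ht
  have hpos : HasDerivAt (fun τ => wellPos F (σ τ))
      (F * wellPos F (σ t) / (1 - (σ t).1) * σ'.1) t := by
    refine ((h1.const_sub 1).rpow_const (Or.inl hx.ne')).congr_deriv ?_
    rw [wellPos, Real.rpow_sub_one hx.ne']
    ring
  have hvel : HasDerivAt (fun τ => wellVel F (σ τ)) _ t := ((hpos.const_mul F).mul h2).neg
  have hpot := (hw.hasDerivAt_pot hs).comp t hpos
  refine (((hvel.fun_pow 2).div_const 2).add hpot).congr_deriv ?_
  rw [loudForce_eq hs, wellPos_rpow hF ht, wellVel, loud]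
  simp only [Nat.cast_ofNat, Nat.add_one_sub_one, pow_one]
  field_simp
  ring

theorem hasDerivAt_ofWell (hF : 0 < F) {x y : ℝ → ℝ} {t : ℝ} (hx : HasDerivAt x (y t) t)
    (hy : HasDerivAt y (-loudForce D F (x t)) t) (h0 : 0 < x t) :
    HasDerivAt (fun τ => ofWell F (x τ) (y τ)) (loud (D, F) (ofWell F (x t) (y t))) t := by
  have h1 := (hx.rpow_const (p := -F⁻¹) (Or.inl h0.ne')).const_sub 1
  have h2 := (hy.div (hx.const_mul F) (mul_pos hF h0).ne').fun_neg
  refine (h1.prodMk h2).congr_deriv ?_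
  rw [loudForce_eq h0, Real.rpow_sub_one h0.ne', loud, ofWell]
  ext
  · simp only
    field_simp
    ring
  · simp only
    field_simp
    ring

theorem continuousOn_wellPos : ContinuousOn (wellPos F) {q | q.1 < 1} := by
  refine ContinuousOn.rpow_const (by fun_prop) fun q hq => Or.inl ?_
  have : q.1 < 1 := hq
  linarith

theorem continuousOn_energy (hw : IsWell (loudForce D F) (loudForceDeriv D F)) :
    ContinuousOn (energy D F) {q | q.1 < 1} := by
  have h1 : ContinuousOn (wellVel F) {q | q.1 < 1} :=
    ((continuousOn_wellPos.const_mul F |>.congr fun _ _ => rfl).mul continuousOn_snd).neg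
  refine ((h1.pow 2).div_const 2).add (hw.continuousOn_pot.comp continuousOn_wellPos ?_)
  exact fun q hq => wellPos_pos hq

theorem isOpen_halfPlane : IsOpen {q : ℝ × ℝ | q.1 < 1} :=
  isOpen_lt continuous_fst continuous_const

theorem isOpen_wellRegion (hw : IsWell (loudForce D F) (loudForceDeriv D F)) :
    IsOpen (wellRegion D F) := by
  have hc := continuousOn_energy hw
  have hs : ContinuousOn (fun q => √(2 * energy D F q)) {q | q.1 < 1} :=
    Real.continuous_sqrt.comp_continuousOn (hc.const_mul 2 |>.congr fun _ _ => rfl)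
  have h1 := hc.isOpen_inter_preimage isOpen_halfPlane (isOpen_Ioi (a := (0 : ℝ)))
  have h2 := hs.isOpen_inter_preimage isOpen_halfPlane hw.isOpen_ampRange
  have h3 := hs.neg.isOpen_inter_preimage isOpen_halfPlane hw.isOpen_ampRange
  convert h1.inter (h2.inter h3) using 1
  ext q
  simp only [wellRegion, mem_ofPred_eq, mem_inter_iff, mem_preimage, mem_Ioi]
  tauto

/-! ### The periodic orbits of the Loud systems -/

theorem exists_polar {x y R : ℝ} (hR : 0 ≤ R) (h : x ^ 2 + y ^ 2 = R ^ 2) :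
    ∃ θ : ℝ, x = R * Real.sin θ ∧ y = R * Real.cos θ := by
  refine ⟨Complex.arg (y + x * Complex.I), ?_⟩
  have hn : ‖(y + x * Complex.I : ℂ)‖ = R := by
    rw [Complex.norm_add_mul_I, add_comm, h, Real.sqrt_sq hR]
  constructor
  · have := Complex.norm_mul_sin_arg (y + x * Complex.I)
    rw [hn] at this
    simpa using this.symm
  · have := Complex.norm_mul_cos_arg (y + x * Complex.I)
    rw [hn] at this
    simpa using this.symm

/-- Every point of the well region lies on a periodic orbit, whose minimal period is the period of
the motion in the well. -/
theorem isLeast_isPeriod (hF : 0 < F) (hw : IsWell (loudForce D F) (loudForceDeriv D F))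
    (hq : q ∈ wellRegion D F) :
    IsLeast {T | IsPeriod (loud (D, F)) q T}
      (IsWell.period (loudForce D F) (loudForceDeriv D F) (√(2 * energy D F q))) := by
  obtain ⟨hq1, hE, hρ, hρ'⟩ := hq
  set ρ := √(2 * energy D F q) with hρdef
  have hρ0 : 0 < ρ := by positivity
  have hs0 := wellPos_pos (F := F) hq1
  obtain ⟨θ, hθ1, hθ2⟩ := exists_polar (x := amp (loudForce D F) (wellPos F q))
    (y := wellVel F q) hρ0.le (by
      rw [hw.amp_sq hs0, hρdef, Real.sq_sqrt (by positivity), energy]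
      ring)
  obtain ⟨Θ, hmono, hsurj, hper, hderiv⟩ := hw.exists_angle hρ hρ'
  obtain ⟨t₀, ht₀⟩ := hsurj θ
  have hmem : ∀ φ, ρ * Real.sin φ ∈ ampRange (loudForce D F) := fun φ =>
    hw.mul_sin_mem_ampRange hρ hρ'
  set γ : ℝ → ℝ × ℝ := fun t =>
    ofWell F (position (loudForce D F) (ρ * Real.sin (Θ (t + t₀)))) (ρ * Real.cos (Θ (t + t₀)))
    with hγ
  have hγ0 : γ 0 = q := by
    simp only [hγ, zero_add, ht₀]
    rw [← hθ1, ← hθ2, hw.position_amp hs0, ofWell_wellPos hF hq1]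
  have hγsol : IsSolution (loud (D, F)) γ := by
    intro t
    have hΘ : HasDerivAt (fun t => Θ (t + t₀))
        (slope (loudForce D F) (loudForceDeriv D F) (ρ * Real.sin (Θ (t + t₀))))⁻¹ t :=
      (hderiv (t + t₀)).comp_add_const t t₀
    have hsl := hw.slope_pos (hmem (Θ (t + t₀)))
    refine hasDerivAt_ofWell hF
      (x := fun t => position (loudForce D F) (ρ * Real.sin (Θ (t + t₀))))
      (y := fun t => ρ * Real.cos (Θ (t + t₀))) ?_ ?_ (position_pos (hmem _))
    · refine ((hw.hasDerivAt_position (hmem _)).comp t (hΘ.sin.const_mul ρ)).congr_deriv ?_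
      field_simp
    · refine (hΘ.cos.const_mul ρ).congr_deriv ?_
      rcases eq_or_ne (ρ * Real.sin (Θ (t + t₀))) 0 with h0 | h0
      · rw [h0, hw.position_zero, hw.map_one]
        linear_combination -(slope (loudForce D F) (loudForceDeriv D F) 0)⁻¹ * h0
      · have := hw.force_position_ne_zero (hmem (Θ (t + t₀))) h0
        rw [slope_of_ne h0, inv_div]
        have h1 := right_ne_zero_of_mul h0
        field_simp
  have hT := hw.period_pos hρ hρ'
  refine ⟨⟨hT, γ, hγsol, hγ0, fun t => ?_⟩, ?_⟩
  · simp only [hγ]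
    rw [add_right_comm, hper, Real.sin_add_two_pi, Real.cos_add_two_pi]
  · rintro T ⟨hT0, δ, hδsol, hδ0, hδper⟩
    have hδ : δ = γ := hδsol.unique (contDiff_loud _) hγsol (hδ0.trans hγ0.symm)
    have h1 : γ T = γ 0 := by
      rw [← hδ]
      simpa using hδper 0
    simp only [hγ, zero_add] at h1
    have h2 := congrArg (wellPos F) h1
    have h3 := congrArg (wellVel F) h1
    rw [wellPos_ofWell hF (position_pos (hmem _)), wellPos_ofWell hF (position_pos (hmem _))] at h2
    rw [wellVel_ofWell hF (position_pos (hmem _)), wellVel_ofWell hF (position_pos (hmem _))] at h3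
    have h4 := mul_left_cancel₀ hρ0.ne' (hw.strictMonoOn_position.injOn (hmem _) (hmem _) h2)
    have h5 := mul_left_cancel₀ hρ0.ne' h3
    obtain ⟨k, hk⟩ := Real.Angle.angle_eq_iff_two_pi_dvd_sub.1 (Real.Angle.cos_sin_inj h5 h4)
    have h6 : Θ t₀ < Θ (T + t₀) := hmono (by linarith)
    have hk0 : (0 : ℝ) < k := by
      have : 0 < 2 * Real.pi * k := by linarith
      exact pos_of_mul_pos_right this Real.two_pi_pos.le
    have hk1 : (1 : ℝ) ≤ k := by exact_mod_cast hk0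
    have h7 : Θ (t₀ + IsWell.period (loudForce D F) (loudForceDeriv D F) ρ) ≤ Θ (T + t₀) := by
      rw [hper]
      nlinarith [Real.two_pi_pos]
    have := hmono.le_iff_le.1 h7
    linarith

theorem period_eq_of_mem (hF : 0 < F) (hw : IsWell (loudForce D F) (loudForceDeriv D F))
    (hq : q ∈ wellRegion D F) : period (loud (D, F)) q =
      IsWell.period (loudForce D F) (loudForceDeriv D F) (√(2 * energy D F q)) :=
  (isLeast_isPeriod hF hw hq).csInf_eq

theorem wellRegion_subset_periodicPoints (hF : 0 < F)
    (hw : IsWell (loudForce D F) (loudForceDeriv D F)) :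
    wellRegion D F ⊆ periodicPoints (loud (D, F)) := by
  intro q hq
  have hleast := isLeast_isPeriod hF hw hq
  refine ⟨fun h0 => ?_, _, hleast.1⟩
  -- a singular point has arbitrarily small periods
  have hT := hleast.1.1
  have : IsPeriod (loud (D, F)) q
      (IsWell.period (loudForce D F) (loudForceDeriv D F) (√(2 * energy D F q)) / 2) := by
    refine ⟨half_pos hT, fun _ => q, fun t => ?_, rfl, fun _ => rfl⟩
    rw [h0]
    exact hasDerivAt_const t q
  have := hleast.2 this
  linarith

/-- The line `u = 1` is invariant. -/
theorem one_sub_fst_eq {a : ℝ × ℝ} {γ : ℝ → ℝ × ℝ} (hγ : IsSolution (loud a) γ) (t : ℝ) :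
    1 - (γ t).1 = (1 - (γ 0).1) * Real.exp (∫ τ in (0 : ℝ)..t, (γ τ).2) := by
  have hc : Continuous γ := continuous_iff_continuousAt.2 fun t => (hγ t).continuousAt
  have hc2 : Continuous fun τ => (γ τ).2 := by fun_prop
  have hI : ∀ t, HasDerivAt (fun t => ∫ τ in (0 : ℝ)..t, (γ τ).2) (γ t).2 t := fun t =>
    (hc2.integral_hasStrictDerivAt 0 t).hasDerivAt
  have h1 : ∀ t, HasDerivAt (fun τ => (γ τ).1) (loud a (γ t)).1 t := fun t =>
    (ContinuousLinearMap.fst ℝ ℝ ℝ).hasFDerivAt.comp_hasDerivAt t (hγ t)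
  have hd : ∀ t, HasDerivAt
      (fun t => (1 - (γ t).1) * Real.exp (-∫ τ in (0 : ℝ)..t, (γ τ).2)) 0 t := by
    intro t
    refine (((h1 t).const_sub 1).mul (hI t).neg.exp).congr_deriv ?_
    simp only [loud]
    ring
  have h2 := is_const_of_deriv_eq_zero (fun t => (hd t).differentiableAt)
    (fun t => (hd t).deriv) t 0
  simp only [intervalIntegral.integral_same, neg_zero, Real.exp_zero, mul_one] at h2
  rw [← h2, mul_assoc, ← Real.exp_add, neg_add_cancel, Real.exp_zero, mul_one]

theorem fst_ne_one_of_mem_periodicPoints (hD : -1 < D) (hF : 0 < F)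
    (hq : q ∈ periodicPoints (loud (D, F))) : q.1 ≠ 1 := by
  intro hq1
  obtain ⟨-, T, hT, γ, hγ, hγ0, hper⟩ := hq
  have hu : ∀ t, (γ t).1 = 1 := by
    intro t
    have := one_sub_fst_eq hγ t
    rw [hγ0, hq1, sub_self, zero_mul] at this
    linarith
  have hv : ∀ t, HasDerivAt (fun t => (γ t).2) (loud (D, F) (γ t)).2 t := fun t =>
    (ContinuousLinearMap.snd ℝ ℝ ℝ).hasFDerivAt.comp_hasDerivAt t (hγ t)
  have hmono : StrictMono fun t => (γ t).2 := by
    refine strictMono_of_hasDerivAt_pos hv fun t => ?_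
    simp only [loud, hu]
    have : 0 ≤ F * (γ t).2 ^ 2 := by positivity
    linarith
  have h1 := hmono hT
  have h2 := hper 0
  rw [zero_add] at h2
  simp [h2] at h1

/-- Conversely, a periodic orbit in `u < 1` lies in the well region. It meets the axis `v = 0` at
its largest position. -/
theorem mem_wellRegion_of_mem_periodicPoints (hF : 0 < F)
    (hw : IsWell (loudForce D F) (loudForceDeriv D F)) (hq1 : q.1 < 1)
    (hq : q ∈ periodicPoints (loud (D, F))) :
    q ∈ wellRegion D F ∧
      ofWell F (position (loudForce D F) (√(2 * energy D F q))) 0 ∈ orbit (loud (D, F)) q := by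
  obtain ⟨hX, T, hT, γ, hγ, hγ0, hper⟩ := hq
  have hc : Continuous γ := continuous_iff_continuousAt.2 fun t => (hγ t).continuousAt
  have hlt : ∀ t, (γ t).1 < 1 := by
    intro t
    have h1 := one_sub_fst_eq hγ t
    rw [hγ0] at h1
    have : 0 < (1 - q.1) * Real.exp (∫ τ in (0 : ℝ)..t, (γ τ).2) :=
      mul_pos (by linarith) (Real.exp_pos _)
    linarith
  have hE : ∀ t, energy D F (γ t) = energy D F q := by
    intro t
    rw [← hγ0]
    refine is_const_of_deriv_eq_zero (f := fun t => energy D F (γ t))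
      (fun t => (hasDerivAt_energy hF hw (hγ t) (hlt t)).differentiableAt) (fun t => ?_) t 0
    rw [(hasDerivAt_energy hF hw (hγ t) (hlt t)).deriv]
    ring
  have hcs : Continuous fun t => wellPos F (γ t) :=
    continuousOn_wellPos.comp_continuous hc hlt
  have hd : ∀ t, HasDerivAt (fun t => wellPos F (γ t)) (wellVel F (γ t)) t := by
    intro t
    have h1 : HasDerivAt (fun τ => (γ τ).1) (loud (D, F) (γ t)).1 t :=
      (ContinuousLinearMap.fst ℝ ℝ ℝ).hasFDerivAt.comp_hasDerivAt t (hγ t)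
    have hx : 0 < 1 - (γ t).1 := by linarith [hlt t]
    refine ((h1.const_sub 1).rpow_const (Or.inl hx.ne')).congr_deriv ?_
    rw [wellVel, wellPos, Real.rpow_sub_one hx.ne', loud]
    field_simp
    ring
  have hpers : Function.Periodic (fun t => wellPos F (γ t)) T := fun t => by
    simp only [hper t]
  -- the turning points
  obtain ⟨tM, -, htM⟩ := isCompact_Icc.exists_isMaxOn (nonempty_Icc.2 hT.le) hcs.continuousOn
  obtain ⟨tm, -, htm⟩ := isCompact_Icc.exists_isMinOn (nonempty_Icc.2 hT.le) hcs.continuousOn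
  have hmax : ∀ t, wellPos F (γ t) ≤ wellPos F (γ tM) := by
    intro t
    obtain ⟨t', ht', he⟩ := hpers.exists_mem_Ico₀ hT t
    rw [he]
    exact htM (Ico_subset_Icc_self ht')
  have hmin : ∀ t, wellPos F (γ tm) ≤ wellPos F (γ t) := by
    intro t
    obtain ⟨t', ht', he⟩ := hpers.exists_mem_Ico₀ hT t
    rw [he]
    exact htm (Ico_subset_Icc_self ht')
  have hvM : wellVel F (γ tM) = 0 :=
    (show IsLocalMax (fun t => wellPos F (γ t)) tM from
      Eventually.of_forall hmax).hasDerivAt_eq_zero (hd tM)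
  have hvm : wellVel F (γ tm) = 0 :=
    (show IsLocalMin (fun t => wellPos F (γ t)) tm from
      Eventually.of_forall hmin).hasDerivAt_eq_zero (hd tm)
  set M := wellPos F (γ tM) with hM
  set m := wellPos F (γ tm) with hm
  have hM0 : 0 < M := wellPos_pos (hlt _)
  have hm0 : 0 < m := wellPos_pos (hlt _)
  have hEM : pot (loudForce D F) M = energy D F q := by
    rw [← hE tM, energy, hvM]
    ring
  have hEm : pot (loudForce D F) m = energy D F q := by
    rw [← hE tm, energy, hvm]
    ring
  have hmM : m < M := by
    refine lt_of_le_of_ne (hmax tm) fun he => hX ?_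
    have hconst : ∀ t, wellPos F (γ t) = M := fun t =>
      le_antisymm (hmax t) (he ▸ hmin t)
    have hv0 : ∀ t, wellVel F (γ t) = 0 := fun t => by
      have := hd t
      simp only [hconst] at this
      exact this.unique (hasDerivAt_const t M)
    have hcon : γ = fun _ => ofWell F M 0 := by
      funext t
      rw [← ofWell_wellPos hF (hlt t), hconst, hv0]
    have h1 := hγ 0
    rw [hγ0, hcon] at h1
    exact h1.unique (hasDerivAt_const _ _)
  have hm1 : m < 1 := by
    by_contra h1
    have := hw.strictMonoOn_pot (mem_Ici.2 (not_lt.1 h1))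
      (mem_Ici.2 ((not_lt.1 h1).trans hmM.le)) hmM
    linarith
  have hM1 : 1 < M := by
    by_contra h1
    have := hw.strictAntiOn_pot ⟨hm0, hmM.le.trans (not_lt.1 h1)⟩ ⟨hM0, not_lt.1 h1⟩ hmM
    linarith
  have haM : amp (loudForce D F) M = √(2 * energy D F q) := by rw [amp, if_pos hM1.le, hEM]
  have ham : amp (loudForce D F) m = -√(2 * energy D F q) := by
    rw [amp, if_neg (not_le.2 hm1), hEm]
  refine ⟨⟨hq1, hEM ▸ hw.pot_pos hM0 hM1.ne', haM ▸ ⟨M, hM0, rfl⟩, ham ▸ ⟨m, hm0, rfl⟩⟩,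
    γ, hγ, hγ0, tM, ?_⟩
  rw [← haM, hw.position_amp hM0, ← hvM, hM, ofWell_wellPos hF (hlt _)]

/-! ### The criterion for a periodic orbit not to be critical -/

/-- If the derivative of the period with respect to the amplitude is not zero, then the orbit is
not critical: the energy has nonzero derivative along each transverse section. -/
theorem not_isCritical (hF : 0 < F) (hw : IsWell (loudForce D F) (loudForceDeriv D F))
    (hq : q ∈ wellRegion D F) {T' : ℝ} (hT' : T' ≠ 0)
    (hT : HasDerivAt (IsWell.period (loudForce D F) (loudForceDeriv D F)) T'
      (√(2 * energy D F q))) : ¬ IsCritical (loud (D, F)) q := by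
  rintro ⟨σ, hσ, rfl, hli, hcrit⟩
  have hσd : HasDerivAt σ (deriv σ 0) 0 := (hσ.differentiableAt one_ne_zero).hasDerivAt
  have hE := hasDerivAt_energy hF hw hσd hq.1
  have hE0 := hq.2.1
  have hcomp := hT.comp 0 ((hE.const_mul 2).sqrt (by positivity))
  have heq : (fun τ => period (loud (D, F)) (σ τ)) =ᶠ[𝓝 0] (IsWell.period (loudForce D F)
      (loudForceDeriv D F) ∘ fun τ => √(2 * energy D F (σ τ))) := by
    filter_upwards [hσd.continuousAt.eventually_mem ((isOpen_wellRegion hw).mem_nhds hq)] with τ hτ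
    exact period_eq_of_mem hF hw hτ
  rw [heq.deriv_eq, hcomp.deriv] at hcrit
  have hs := wellPos_pos (F := F) hq.1
  have hx : 0 < 1 - (σ 0).1 := by linarith [hq.1]
  have hsq : 0 < √(2 * energy D F (σ 0)) := by positivity
  have hdet : (loud (D, F) (σ 0)).2 * (deriv σ 0).1 - (loud (D, F) (σ 0)).1 * (deriv σ 0).2 = 0 := by
    have h1 := (mul_eq_zero.1 hcrit).resolve_left hT'
    rw [div_eq_zero_iff] at h1
    have h2 := h1.resolve_right (by positivity)
    have h3 := (mul_eq_zero.1 h2).resolve_left two_ne_zero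
    exact (mul_eq_zero.1 h3).resolve_left (by positivity)
  rw [LinearIndependent.pair_iff] at hli
  set X := loud (D, F) (σ 0)
  set w := deriv σ 0
  have h1 := hli w.1 (-X.1) (by
    ext
    · simp only [Prod.fst_add, Prod.smul_fst, smul_eq_mul, Prod.fst_zero]
      ring
    · simp only [Prod.snd_add, Prod.smul_snd, smul_eq_mul, Prod.snd_zero]
      linarith)
  have h2 := hli w.2 (-X.2) (by
    ext
    · simp only [Prod.fst_add, Prod.smul_fst, smul_eq_mul, Prod.fst_zero]
      linarith
    · simp only [Prod.snd_add, Prod.smul_snd, smul_eq_mul, Prod.snd_zero]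
      ring)
  have h3 := hli 1 0 (by
    ext
    · simpa using h1.2
    · simpa using h2.2)
  exact one_ne_zero h3.1

end PlanarCenter

namespace PlanarCenter

open IsWell

/-! ### The Poincaré disc and the outer boundary -/

theorem continuous_toDisc : Continuous toDisc := by
  have h : ∀ q : ℝ × ℝ, √(1 + q.1 ^ 2 + q.2 ^ 2) ≠ 0 := fun q => by positivity
  exact Continuous.prodMk (Continuous.div (by fun_prop) (by fun_prop) h)
    (Continuous.div (by fun_prop) (by fun_prop) h)

theorem isOpenMap_toDisc : IsOpenMap toDisc := by
  intro O hO
  set g : ℝ × ℝ → ℝ × ℝ := fun w =>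
    (w.1 / √(1 - w.1 ^ 2 - w.2 ^ 2), w.2 / √(1 - w.1 ^ 2 - w.2 ^ 2)) with hg
  have hball : IsOpen {w : ℝ × ℝ | 0 < 1 - w.1 ^ 2 - w.2 ^ 2} :=
    isOpen_lt continuous_const (by fun_prop)
  have hgc : ContinuousOn g {w : ℝ × ℝ | 0 < 1 - w.1 ^ 2 - w.2 ^ 2} := by
    have h : ∀ w ∈ {w : ℝ × ℝ | 0 < 1 - w.1 ^ 2 - w.2 ^ 2}, √(1 - w.1 ^ 2 - w.2 ^ 2) ≠ 0 :=
      fun w hw => (Real.sqrt_pos.2 hw).ne'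
    exact ContinuousOn.prodMk (ContinuousOn.div (by fun_prop) (by fun_prop) h)
      (ContinuousOn.div (by fun_prop) (by fun_prop) h)
  convert hgc.isOpen_inter_preimage hball hO using 1
  ext w
  constructor
  · rintro ⟨q, hq, rfl⟩
    have hr : 0 < 1 + q.1 ^ 2 + q.2 ^ 2 := by positivity
    have h1 : 1 - (toDisc q).1 ^ 2 - (toDisc q).2 ^ 2 = (1 + q.1 ^ 2 + q.2 ^ 2)⁻¹ := by
      simp only [toDisc, div_pow, Real.sq_sqrt hr.le]
      field_simp
      ring
    refine ⟨?_, ?_⟩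
    · change 0 < 1 - (toDisc q).1 ^ 2 - (toDisc q).2 ^ 2
      rw [h1]
      positivity
    · have : g (toDisc q) = q := by
        simp only [hg, h1, Real.sqrt_inv]
        simp only [toDisc]
        ext <;> field_simp
      rwa [mem_preimage, this]
  · rintro ⟨hw, hgw⟩
    have hw : 0 < 1 - w.1 ^ 2 - w.2 ^ 2 := hw
    refine ⟨g w, hgw, ?_⟩
    have h1 : 1 + (g w).1 ^ 2 + (g w).2 ^ 2 = (1 - w.1 ^ 2 - w.2 ^ 2)⁻¹ := by
      simp only [hg, div_pow, Real.sq_sqrt hw.le]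
      field_simp
      ring
    simp only [toDisc, h1, Real.sqrt_inv]
    simp only [hg]
    ext <;> field_simp

theorem isOpen_periodAnnulus (X : ℝ × ℝ → ℝ × ℝ) (p : ℝ × ℝ) : IsOpen (periodAnnulus X p) := by
  refine isOpen_iff_mem_nhds.2 fun q hq => ?_
  obtain ⟨hqp, N, hNo, hNc, hpN, hqN, hN⟩ := hq
  refine mem_of_superset ((hNo.sdiff isClosed_singleton).mem_nhds ⟨hqN, hqp⟩) fun r hr => ?_
  exact ⟨hr.2, N, hNo, hNc, hpN, hr.1, hN⟩

/-- A compact part of the period annulus, together with the center, can be cut out of the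
Poincaré disc: what remains is a neighbourhood of the outer boundary. -/
theorem compl_image_mem_nhdsSet_outerBoundary {X : ℝ × ℝ → ℝ × ℝ} {p : ℝ × ℝ} {K : Set (ℝ × ℝ)}
    (hK : IsCompact K) (h : ∀ k ∈ K, k ≠ p → k ∈ periodAnnulus X p) :
    (toDisc '' K)ᶜ ∈ 𝓝ˢ (outerBoundary X p) := by
  refine (hK.image continuous_toDisc).isClosed.isOpen_compl.mem_nhdsSet.2 ?_
  rintro w ⟨hw, hwp⟩ ⟨k, hk, rfl⟩
  have hkp : k ≠ p := fun he => hwp (he ▸ rfl)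
  have ho : IsOpen (toDisc '' periodAnnulus X p) := isOpenMap_toDisc _ (isOpen_periodAnnulus X p)
  rw [ho.frontier_eq] at hw
  exact hw.2 ⟨k, h k hk hkp, rfl⟩

/-! ### The period annulus of the Loud systems -/

variable {D F R : ℝ} {q : ℝ × ℝ}

theorem energy_pos (hF : 0 < F) (hw : IsWell (loudForce D F) (loudForceDeriv D F))
    (hq1 : q.1 < 1) (hq0 : q ≠ 0) : 0 < energy D F q := by
  have hs := wellPos_pos (F := F) hq1
  have hp := hw.pot_nonneg hs
  rcases eq_or_ne (wellPos F q) 1 with h1 | h1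
  · have hv : wellVel F q ≠ 0 := by
      intro hv
      apply hq0
      rw [← ofWell_wellPos hF hq1, hv, h1]
      simp [ofWell]
    have := sq_pos_of_ne_zero hv
    rw [energy]
    linarith
  · have := hw.pot_pos hs h1
    have := sq_nonneg (wellVel F q)
    rw [energy]
    linarith

@[simp] theorem energy_zero : energy D F 0 = 0 := by
  simp [energy, wellVel, wellPos]

/-- The points of energy less than `R ^ 2 / 2`. -/
def sublevel (D F R : ℝ) : Set (ℝ × ℝ) := {q | q.1 < 1 ∧ √(2 * energy D F q) < R}

theorem sublevel_diff_subset (hF : 0 < F) (hw : IsWell (loudForce D F) (loudForceDeriv D F))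
    (hR : R ∈ ampRange (loudForce D F)) (hR' : -R ∈ ampRange (loudForce D F)) :
    sublevel D F R \ {0} ⊆ wellRegion D F := by
  rintro q ⟨⟨hq1, hqR⟩, hq0⟩
  have hs := Real.sqrt_nonneg (2 * energy D F q)
  exact ⟨hq1, energy_pos hF hw hq1 hq0,
    hw.ordConnected_ampRange.out hR' hR ⟨by linarith, by linarith⟩,
    hw.ordConnected_ampRange.out hR' hR ⟨by linarith, by linarith⟩⟩

theorem isOpen_sublevel (hw : IsWell (loudForce D F) (loudForceDeriv D F)) :
    IsOpen (sublevel D F R) := by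
  have hs : ContinuousOn (fun q => √(2 * energy D F q)) {q | q.1 < 1} :=
    Real.continuous_sqrt.comp_continuousOn (continuousOn_const.mul (continuousOn_energy hw))
  exact hs.isOpen_inter_preimage isOpen_halfPlane isOpen_Iio

/-- The sublevel sets are discs in the coordinates `(amplitude, velocity)`. -/
theorem isConnected_sublevel (hF : 0 < F) (hw : IsWell (loudForce D F) (loudForceDeriv D F))
    (hR0 : 0 < R) (hR : R ∈ ampRange (loudForce D F)) (hR' : -R ∈ ampRange (loudForce D F)) :
    IsConnected (sublevel D F R) := by
  set Φ : ℝ × ℝ → ℝ × ℝ := fun z =>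
    ofWell F (position (loudForce D F) (z.1 * Real.sin z.2)) (z.1 * Real.cos z.2) with hΦ
  have hmem : ∀ z ∈ Ico 0 R ×ˢ (univ : Set ℝ), z.1 * Real.sin z.2 ∈ ampRange (loudForce D F) :=
    fun z hz => hw.mul_sin_mem_ampRange
      (hw.ordConnected_ampRange.out hR' hR ⟨by linarith [hz.1.1], hz.1.2.le⟩)
      (hw.ordConnected_ampRange.out hR' hR ⟨by linarith [hz.1.2], by linarith [hz.1.1]⟩)
  have himg : sublevel D F R = Φ '' (Ico 0 R ×ˢ univ) := by
    ext q
    constructor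
    · rintro ⟨hq1, hqR⟩
      have hs := wellPos_pos (F := F) hq1
      have hE : 0 ≤ energy D F q := by
        have := hw.pot_nonneg hs
        rw [energy]
        positivity
      obtain ⟨θ, h1, h2⟩ := exists_polar (x := amp (loudForce D F) (wellPos F q))
        (y := wellVel F q) (Real.sqrt_nonneg (2 * energy D F q)) (by
          rw [hw.amp_sq hs, Real.sq_sqrt (by positivity), energy]
          ring)
      refine ⟨(√(2 * energy D F q), θ), ⟨⟨Real.sqrt_nonneg _, hqR⟩, mem_univ _⟩, ?_⟩
      simp only [hΦ]
      rw [← h1, ← h2, hw.position_amp hs, ofWell_wellPos hF hq1]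
    · rintro ⟨z, hz, rfl⟩
      have hp := position_pos (hmem z hz)
      refine ⟨ofWell_fst_lt hp, ?_⟩
      have : 2 * energy D F (Φ z) = z.1 ^ 2 := by
        simp only [hΦ]
        rw [energy, wellPos_ofWell hF hp, wellVel_ofWell hF hp, mul_add,
          hw.two_mul_pot_position (hmem z hz)]
        linear_combination z.1 ^ 2 * Real.sin_sq_add_cos_sq z.2
      rw [this, Real.sqrt_sq hz.1.1]
      exact hz.1.2
  have hpos : ContinuousOn (fun z : ℝ × ℝ => position (loudForce D F) (z.1 * Real.sin z.2))
      (Ico 0 R ×ˢ univ) := fun z hz =>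
    (ContinuousAt.comp (f := fun z : ℝ × ℝ => z.1 * Real.sin z.2)
      (hw.continuousAt_position (hmem z hz)) (by fun_prop)).continuousWithinAt
  have hcont : ContinuousOn Φ (Ico 0 R ×ˢ univ) := by
    refine ContinuousOn.prodMk ?_ (ContinuousOn.neg (ContinuousOn.div ?_ ?_ ?_))
    · exact continuousOn_const.sub (hpos.rpow_const fun z hz =>
        Or.inl (position_pos (hmem z hz)).ne')
    · fun_prop
    · exact continuousOn_const.mul hpos
    · exact fun z hz => (mul_pos hF (position_pos (hmem z hz))).ne'
  rw [himg]
  exact ⟨⟨Φ (0, 0), (0, 0), ⟨⟨le_rfl, hR0⟩, mem_univ _⟩, rfl⟩,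
    (isPreconnected_Ico.prod isPreconnected_univ).image _ hcont⟩

theorem sublevel_diff_subset_periodAnnulus (hF : 0 < F)
    (hw : IsWell (loudForce D F) (loudForceDeriv D F)) (hR0 : 0 < R)
    (hR : R ∈ ampRange (loudForce D F)) (hR' : -R ∈ ampRange (loudForce D F)) :
    sublevel D F R \ {0} ⊆ periodAnnulus (loud (D, F)) 0 := by
  rintro q hq
  refine ⟨hq.2, sublevel D F R, isOpen_sublevel hw, isConnected_sublevel hF hw hR0 hR hR', ?_,
    hq.1, (sublevel_diff_subset hF hw hR hR').trans (wellRegion_subset_periodicPoints hF hw)⟩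
  exact ⟨zero_lt_one, by simpa using hR0⟩

theorem isCenter_loud (hF : 0 < F) (hw : IsWell (loudForce D F) (loudForceDeriv D F)) :
    IsCenter (loud (D, F)) 0 := by
  refine ⟨by simp [loud], ?_⟩
  obtain ⟨ε, hε, hball⟩ := Metric.mem_nhds_iff.1 (hw.ampRange_mem_nhds zero_mem_ampRange)
  have hmem : ∀ r : ℝ, |r| < ε → r ∈ ampRange (loudForce D F) := fun r hr =>
    hball (by simpa using hr)
  have hε2 : |ε / 2| < ε := by
    rw [abs_of_pos (half_pos hε)]
    linarith
  have hR := hmem (ε / 2) hε2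
  have hR' := hmem (-(ε / 2)) (by rwa [abs_neg])
  have h0 : (0 : ℝ × ℝ) ∈ sublevel D F (ε / 2) := ⟨zero_lt_one, by simpa using hε⟩
  filter_upwards [nhdsWithin_le_nhds ((isOpen_sublevel hw).mem_nhds h0), self_mem_nhdsWithin]
    with q hq hq0
  exact wellRegion_subset_periodicPoints hF hw (sublevel_diff_subset hF hw hR hR' ⟨hq, hq0⟩)

theorem mem_periodicPoints_of_mem_periodAnnulus (hD : -1 < D) (hF : 0 < F)
    (hq : q ∈ periodAnnulus (loud (D, F)) 0) :
    q ∈ periodicPoints (loud (D, F)) ∧ q.1 < 1 := by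
  obtain ⟨hq0, N, -, hNc, h0N, hqN, hN⟩ := hq
  refine ⟨hN ⟨hqN, hq0⟩, ?_⟩
  by_contra hlt
  have hpre : (Prod.fst '' N).OrdConnected :=
    (hNc.isPreconnected.image _ continuous_fst.continuousOn).ordConnected
  obtain ⟨r, hr, hr1⟩ := hpre.out ⟨0, h0N, rfl⟩ ⟨q, hqN, rfl⟩
    (show (1 : ℝ) ∈ Icc (0 : ℝ × ℝ).1 q.1 from ⟨zero_le_one, not_lt.1 hlt⟩)
  have hr0 : r ≠ 0 := by
    rintro rfl
    exact zero_ne_one hr1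
  exact fst_ne_one_of_mem_periodicPoints hD hF (hN ⟨hr, hr0⟩) hr1

/-- The part of the axis `v = 0` where the position does not exceed a bound that is below the
height of the wall lies in the period annulus. -/
theorem axis_mem_periodAnnulus (hF : 0 < F) (hw : IsWell (loudForce D F) (loudForceDeriv D F))
    {M m u : ℝ} (hm0 : 0 < m) (hm1 : m < 1) (hM : 1 < M)
    (hpot : pot (loudForce D F) M ≤ pot (loudForce D F) m) (hu0 : 0 < u) (hu1 : u < 1)
    (hu : (1 - u) ^ (-F) < M) : ((u, 0) : ℝ × ℝ) ∈ periodAnnulus (loud (D, F)) 0 := by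
  have hM0 : 0 < M := one_pos.trans hM
  have hR : amp (loudForce D F) M ∈ ampRange (loudForce D F) := ⟨M, hM0, rfl⟩
  have hR0 := hw.amp_pos hM
  have hm : amp (loudForce D F) m ≤ -amp (loudForce D F) M := by
    rw [amp, if_neg (not_le.2 hm1), amp, if_pos hM.le]
    exact neg_le_neg (Real.sqrt_le_sqrt (by linarith))
  have hR' : -amp (loudForce D F) M ∈ ampRange (loudForce D F) :=
    hw.ordConnected_ampRange.out ⟨m, hm0, rfl⟩ hR ⟨hm, by linarith⟩
  refine sublevel_diff_subset_periodAnnulus hF hw hR0 hR hR' ⟨⟨hu1, ?_⟩, ?_⟩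
  · have h1 : energy D F (u, 0) = pot (loudForce D F) ((1 - u) ^ (-F)) := by
      simp [energy, wellVel, wellPos]
    have h2 : 1 ≤ (1 - u) ^ (-F) :=
      Real.one_le_rpow_of_pos_of_le_one_of_nonpos (by linarith) (by linarith) (by linarith)
    rw [h1, amp, if_pos hM.le]
    refine Real.sqrt_lt_sqrt (mul_nonneg two_pos.le (hw.pot_nonneg (by linarith))) ?_
    have := hw.strictMonoOn_pot (mem_Ici.2 h2) (mem_Ici.2 hM.le) hu
    linarith
  · intro he
    exact hu0.ne' (congrArg Prod.fst he)

end PlanarCenter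

open PlanarCenter IsWell

theorem theoremC (D : ℝ) (hD : D ∈ Set.Ioo (-1 : ℝ) 0) (hD' : D ≠ -1 / 2) :
    PlanarCenter.IsLocalRegularValueAtOuterBoundary
      PlanarCenter.loud (0 : ℝ × ℝ) ((D, 1) : ℝ × ℝ) := by
  obtain ⟨hD1, hD0⟩ := hD
  have hb : 0 < |1 + 2 * D| := abs_pos.2 fun h => hD' (by linarith)
  obtain ⟨κ, hκ0, hκ⟩ := exists_between (lt_min (lt_min (by linarith : 0 < 1 + D)
    (by linarith : 0 < -D)) hb)
  obtain ⟨hκ, hκb⟩ := lt_min_iff.1 hκ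
  obtain ⟨hκa, hκc⟩ := lt_min_iff.1 hκ
  obtain ⟨η₀, hη₀, M₀, hM₀⟩ := WallBounds.exists_forall_deriv_period_ne_zero κ 2 hκ0 one_le_two
  set M₁ := max M₀ 2 with hM₁
  have hM₁2 : 2 ≤ M₁ := le_max_right _ _
  have hM₁0 : 0 < M₁ := by linarith
  set M₂ := M₁ ^ (4 : ℝ) + 1 with hM₂
  have hM₁4 : 0 < M₁ ^ (4 : ℝ) := by positivity
  -- `exp (-k)` is so close to the wall that the potential there is higher than at `M₂`
  set k := 2 * (16 * M₂ ^ 2 / κ + 2) with hk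
  have hk0 : 0 < k := by positivity
  set x₁ := M₁ ^ (-2 : ℝ) with hx₁
  have hx₁0 : 0 < x₁ := by positivity
  set K : Set (ℝ × ℝ) := Icc 0 (1 - x₁) ×ˢ {0} with hK
  have hKc : IsCompact K := isCompact_Icc.prod isCompact_singleton
  have hU : ∀ᶠ a in 𝓝 ((D, 1) : ℝ × ℝ), (-1 < a.1 ∧ 1 / 2 < a.2 ∧ a.2 < 2) ∧
      (κ < a.2 * (1 + a.1) ∧ κ < -(a.2 * a.1) ∧ a.2 * (1 + a.1) < 2 ∧ -(a.2 * a.1) < 2) ∧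
      κ < |a.2 * (1 + a.1) - -(a.2 * a.1)| ∧
      (|1 - a.2⁻¹| < 1 / 16 ∧ |1 - a.2⁻¹| < η₀ ∧ |1 - a.2⁻¹| < 1 / (4 * k)) := by
    have hinv : ContinuousAt (fun a : ℝ × ℝ => |1 - a.2⁻¹|) (D, 1) :=
      (continuousAt_const.sub (continuousAt_snd.inv₀ one_ne_zero)).abs
    have hη : ∀ ε > 0, ∀ᶠ a : ℝ × ℝ in 𝓝 (D, 1), |1 - a.2⁻¹| < ε := fun ε hε =>
      hinv.eventually_lt_const (by simpa using hε)
    have hlt : ∀ g : ℝ × ℝ → ℝ, Continuous g → ∀ y, y < g (D, 1) →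
        ∀ᶠ a in 𝓝 (D, 1), y < g a := fun g hg y hy => hg.continuousAt.eventually_const_lt hy
    have hgt : ∀ g : ℝ × ℝ → ℝ, Continuous g → ∀ y, g (D, 1) < y →
        ∀ᶠ a in 𝓝 (D, 1), g a < y := fun g hg y hy => hg.continuousAt.eventually_lt_const hy
    refine Filter.Eventually.and ?_ (Filter.Eventually.and ?_ (Filter.Eventually.and ?_ ?_))
    · exact (hlt (fun a => a.1) (by fun_prop) _ hD1).and
        ((hlt (fun a => a.2) (by fun_prop) _ (by norm_num)).and
          (hgt (fun a => a.2) (by fun_prop) _ (by norm_num)))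
    · exact (hlt (fun a => a.2 * (1 + a.1)) (by fun_prop) _ (by simpa using hκa)).and
        ((hlt (fun a => -(a.2 * a.1)) (by fun_prop) _ (by simpa using hκc)).and
          ((hgt (fun a => a.2 * (1 + a.1)) (by fun_prop) _ (by simp only; linarith)).and
            (hgt (fun a => -(a.2 * a.1)) (by fun_prop) _ (by simp only; linarith))))
    · refine hlt (fun a => |a.2 * (1 + a.1) - -(a.2 * a.1)|) (by fun_prop) _ ?_
      rwa [show (1 : ℝ) * (1 + D) - -(1 * D) = 1 + 2 * D by ring]
    · exact (hη _ (by norm_num)).and ((hη _ hη₀).and (hη _ (by positivity)))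
  refine ⟨_, hU, (toDisc '' K)ᶜ, ?_⟩
  rintro ⟨D', F⟩ ⟨⟨hD'1, hF1, hF2⟩, ⟨ha1, hc1, ha2, hc2⟩, hac, hη1, hη2, hη3⟩
  simp only at hD'1 hF1 hF2 ha1 hc1 ha2 hc2 hac hη1 hη2 hη3
  have hF : 0 < F := by linarith
  have hwb : WallBounds κ 2 (F * (1 + D')) (-(F * D')) (1 - F⁻¹) :=
    ⟨hκ0, one_le_two, ha1.le, hc1.le, ha2.le, hc2.le, hη1.le⟩
  have hw : IsWell (loudForce D' F) (loudForceDeriv D' F) := hwb.isWell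
  refine ⟨isCenter_loud hF hw, compl_image_mem_nhdsSet_outerBoundary hKc ?_, ?_⟩
  · rintro ⟨u, v⟩ ⟨⟨hu0, hu1⟩, hv⟩ hne
    simp only [mem_singleton_iff] at hu0 hu1 hv
    subst hv
    have hu0' : 0 < u := lt_of_le_of_ne hu0 fun h => hne (by rw [← h]; rfl)
    refine axis_mem_periodAnnulus hF hw (Real.exp_pos (-k)) (Real.exp_lt_one_iff.2 (by linarith))
      (M := M₂) (by linarith) ?_ hu0' (by linarith) ?_
    · have h1 : pot (loudForce D' F) M₂ ≤ 2 * 2 * (M₂ - 1) ^ 2 := hwb.pot_le (by linarith)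
      have h2 : κ / 4 * (k / 2 - 2) ≤ pot (loudForce D' F) (Real.exp (-k)) := by
        refine hwb.pot_exp_ge hk0.le ?_
        rw [lt_div_iff₀ (by positivity)] at hη3
        linarith
      have h3 : κ / 4 * (k / 2 - 2) = 4 * M₂ ^ 2 := by
        rw [hk]
        field_simp
        ring
      have h4 : (M₂ - 1) ^ 2 ≤ M₂ ^ 2 := by
        gcongr <;> linarith
      linarith
    · calc (1 - u) ^ (-F) ≤ x₁ ^ (-F) :=
            Real.rpow_le_rpow_of_nonpos hx₁0 (by linarith) (by linarith)
        _ = M₁ ^ (2 * F) := by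
            rw [hx₁, ← Real.rpow_mul hM₁0.le]
            congr 1
            ring
        _ ≤ M₁ ^ (4 : ℝ) := Real.rpow_le_rpow_of_exponent_le (by linarith) (by linarith)
        _ < M₂ := by linarith
  · intro q hq hV
    obtain ⟨hqp, hq1⟩ := mem_periodicPoints_of_mem_periodAnnulus hD'1 hF hq
    obtain ⟨hreg, horb⟩ := mem_wellRegion_of_mem_periodicPoints hF hw hq1 hqp
    have hρ0 : 0 < √(2 * energy D' F q) := by
      have := hreg.2.1
      positivity
    rcases lt_or_ge M₀ (position (loudForce D' F) (√(2 * energy D' F q))) with hlt | hge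
    · obtain ⟨T', hT', hd⟩ := hM₀ _ _ _ hwb hη2.le hac.le _ hreg.2.2.1 hreg.2.2.2 hρ0 hlt
      exact not_isCritical hF hw hreg hT' hd
    · -- a smaller orbit meets the segment that was cut out
      refine absurd ⟨_, ?_, rfl⟩ (hV ⟨_, horb, rfl⟩)
      have h1 := hw.one_lt_position hreg.2.2.1 hρ0
      set M := position (loudForce D' F) (√(2 * energy D' F q))
      have hFi : 0 < F⁻¹ := by positivity
      have hFi2 : F⁻¹ ≤ 2 := by
        rw [inv_le_comm₀ hF two_pos]
        linarith
      refine ⟨⟨?_, ?_⟩, by simp [ofWell]⟩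
      · have : M ^ (-F⁻¹) ≤ 1 := Real.rpow_le_one_of_one_le_of_nonpos h1.le (by linarith)
        simp only [ofWell]
        linarith
      · have h2 : x₁ ≤ M ^ (-F⁻¹) := by
          calc x₁ ≤ M₁ ^ (-F⁻¹) :=
                Real.rpow_le_rpow_of_exponent_le (by linarith) (by linarith)
            _ ≤ M ^ (-F⁻¹) := Real.rpow_le_rpow_of_nonpos (by linarith)
                (hge.trans (le_max_left _ _)) (by linarith)
        simp only [ofWell]
        linarith
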